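/- Let $n,k\ge 0$, let $Q$ be a smooth $n$-dimensional manifold, $T^1_kQ=TQ\oplus\overset{k}{\cdots}\oplus TQ$ and $(T^1_k)^*Q=T^*Q\oplus\overset{k}{\cdots}\oplus T^*Q$ with induced coordinates $(q^i,v^i_A)$ and $(q^i,p^A_i)$, and let $pr_1,pr_2$ be the projections of $T^1_kQ\oplus_Q(T^1_k)^*Q$ onto its factors. Let $(\theta_0)_A$ be the Liouville 1-forms on $(T^1_k)^*Q$ (locally $p^A_i\,dq^i$), $(\omega_0)_A=-d(\theta_0)_A$ and $\Omega_A=pr_2^*(\omega_0)_A$. Let $L:T^1_kQ\to\mathbb R$ be a smooth Lagrangian which is regular, i.e. $\det\big(\partial^2L/\partial v^i_A\partial v^j_B\big)\neq0$ everywhere. Let $FL:T^1_kQ\to(T^1_k)^*Q$ be its Legendre map, $$[FL(v_1,\dots,v_k)]^A(w)=\tfrac{d}{ds}\big|_{s=0}L(v_1,\dots,v_A+sw,\dots,v_k),$$ let $E_L=C(L)-L$ be its energy, where $C$ is the Liouville vector field on $T^1_kQ$ (the generator of the flow $(s,v)\mapsto e^sv$), let $M_L=\{(v,\alpha):\alpha=FL(v)\}\subset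 T^1_kQ\oplus_Q(T^1_k)^*Q$ be the graph of $FL$, and let $\mathcal H(v,\alpha)=\sum_{A}\alpha^A(v_A)-L(v)$. Let $\mathbf Z=(Z_1,\dots,Z_k)$ be a smooth $k$-vector field on $T^1_kQ\oplus_Q(T^1_k)^*Q$ which is integrable at the points of $M_L$ (an integral section of $\mathbf Z$ passes through each point of $M_L$) and satisfies $$\sum_{A=1}^k\iota_{Z_A}\Omega_A=d\mathcal H\qquad\text{at every point of }M_L .$$ Let $\psi:U_0\to T^1_kQ\oplus_Q(T^1_k)^*Q$ be an integral section of $\mathbf Z$ with values in $M_L$, defined on an open neighbourhood $U_0$ of $0$ in $\mathbb R^k$ (for instance $U_0=\mathbb R^k$); that is, $\psi$ is smooth and $\psi_*(t)(\partial/\partial t^A)=Z_A(\psi(t))$ for all $t\in U_0$ and $1\le A\le k$. Put $\psi_L=pr_1\circ\psi$ and $\psi_H=FL\circ\psi_L$. Then: 1. Every point of $T^1_kQ$ has an open neighbourhood $U$ on which $FL$ is injective and such that $FL(U)$ is open and there is a smooth function $H$ on $FL(U)$ with $H\circ FL=E_L$ on $U$. 2. For every open $U\subset T^1_kQ$ and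 every real function $H$ on $(T^1_k)^*Q$ with $H\circ FL=E_L$ on $U$ (only its values on $FL(U)$ matter), the set $V=\psi_L^{-1}(U)\subset U_0$ is open, $\psi_H$ is smooth on $V$, $H$ is smooth near each point of $\psi_H(V)$, and $\psi_H|_V$ is a solution of the Hamilton–De Donder–Weyl field equations for $H$: in all induced local coordinates $(q^i,p^A_i)$, writing $\psi_H=(\psi^i,\psi^A_i)$, $$\frac{\partial H}{\partial q^i}\Big|_{\psi_H(t)}=-\sum_{A=1}^k\frac{\partial\psi^A_i}{\partial t^A}(t),\qquad \frac{\partial H}{\partial p^A_i}\Big|_{\psi_H(t)}=\frac{\partial\psi^i}{\partial t^A}(t).$$ -/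

import Mathlib

open scoped Manifold ContDiff Topology
open Bundle

noncomputable section

namespace KSymplectic

/-! ### The bundles -/

/-- The space `ℝᵐ`, used both as model space of an `m`-dimensional manifold and as the space of
independent variables of a field. -/
abbrev Euc (m : ℕ) : Type := EuclideanSpace ℝ (Fin m)

/-- The `A`-th vector of the canonical basis of `ℝᵐ`. -/
abbrev basisVec {m : ℕ} (A : Fin m) : Euc m := EuclideanSpace.single A (1 : ℝ)

section Bundles

variable (n k : ℕ) (Q : Type*) [TopologicalSpace Q] [ChartedSpace (Euc n) Q]
  [IsManifold (𝓡 n) ∞ Q]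

/-- The fibre of `T¹ₖQ = J¹₀(ℝᵏ, Q)` over `q`: the linear maps `v : ℝᵏ → T_q Q`. The `k`-tuple of
tangent vectors given by such a map is `v_A = v (e_A)`. -/
abbrev VelFiber (q : Q) : Type :=
  Bundle.Trivial Q (Euc k) q →L[ℝ] TangentSpace (𝓡 n) q

/-- The fibre of `(T¹ₖ)*Q = J¹(Q, ℝᵏ)₀` over `q`: the linear maps `α : T_q Q → ℝᵏ`. The `k`-tuple
of covectors given by such a map is `α^A = (α ·)_A`. -/
abbrev CovFiber (q : Q) : Type :=
  TangentSpace (𝓡 n) q →L[ℝ] Bundle.Trivial Q (Euc k) q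

/-- The tangent bundle of `k¹`-velocities `T¹ₖQ`. -/
abbrev Vel : Type _ := TotalSpace (Euc k →L[ℝ] Euc n) (VelFiber n k Q)

/-- The cotangent bundle of `k¹`-covelocities `(T¹ₖ)*Q`. -/
abbrev Cov : Type _ := TotalSpace (Euc n →L[ℝ] Euc k) (CovFiber n k Q)

/-- The Whitney sum `T¹ₖQ ⊕_Q (T¹ₖ)*Q`. -/
abbrev Whitney : Type _ :=
  TotalSpace ((Euc k →L[ℝ] Euc n) × (Euc n →L[ℝ] Euc k)) (VelFiber n k Q ×ᵇ CovFiber n k Q)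

end Bundles

/-- The model with corners of the manifold `T¹ₖQ`. -/
abbrev velModel (n k : ℕ) := (𝓡 n).prod 𝓘(ℝ, Euc k →L[ℝ] Euc n)

/-- The model with corners of the manifold `(T¹ₖ)*Q`. -/
abbrev covModel (n k : ℕ) := (𝓡 n).prod 𝓘(ℝ, Euc n →L[ℝ] Euc k)

/-- The model with corners of the manifold `T¹ₖQ ⊕_Q (T¹ₖ)*Q`. -/
abbrev whitneyModel (n k : ℕ) :=
  (𝓡 n).prod 𝓘(ℝ, (Euc k →L[ℝ] Euc n) × (Euc n →L[ℝ] Euc k))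

/-! ### Exterior derivative of a 1-form, `k`-vector fields and integral sections -/

section General

variable {E : Type*} [NormedAddCommGroup E] [NormedSpace ℝ E] {H : Type*} [TopologicalSpace H]
  (I : ModelWithCorners ℝ E H) {M : Type*} [TopologicalSpace M] [ChartedSpace H M]

/-- The local expression of a 1-form `θ` in the preferred chart at `x₀`: its pull-back along the
inverse of that chart. -/
def localOneForm (θ : (x : M) → TangentSpace I x →L[ℝ] ℝ) (x₀ : M) (y : E) : E →L[ℝ] ℝ :=
  (θ ((extChartAt I x₀).symm y)).comp
    (mfderivWithin 𝓘(ℝ, E) I (extChartAt I x₀).symm (Set.range I) y : E →L[ℝ] _)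

/-- The exterior derivative of a 1-form `θ` at `x₀`, computed in the preferred chart at `x₀`:
`dθ(u, w) = D_u θ (w) - D_w θ (u)`. -/
def extDerivOneForm (θ : (x : M) → TangentSpace I x →L[ℝ] ℝ) (x₀ : M)
    (u w : TangentSpace I x₀) : ℝ :=
  let D : E →L[ℝ] E →L[ℝ] ℝ :=
    fderivWithin ℝ (localOneForm I θ x₀) (Set.range I) (extChartAt I x₀ x₀)
  let u' : E := mfderiv I 𝓘(ℝ, E) (extChartAt I x₀) x₀ u
  let w' : E := mfderiv I 𝓘(ℝ, E) (extChartAt I x₀) x₀ w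
  D u' w' - D w' u'

variable (M) in
/-- A (smooth) `k`-vector field on `M`, given by its `k` components `X_1, …, X_k`. -/
structure KVectorField [IsManifold I 1 M] (k : ℕ) where
  /-- The components. -/
  comp : Fin k → (x : M) → TangentSpace I x
  smooth : ∀ A, ContMDiff I I.tangent ∞ (fun x => (⟨x, comp A x⟩ : TangentBundle I M))

variable {I}

/-- `φ : U₀ ⊆ ℝᵏ → M` is an integral section of `X`, where `U₀` is an open neighbourhood of `0`:
`φ_*(t)(∂/∂t^A) = X_A(φ(t))` for all `t ∈ U₀` and all `A`. Only the values of `φ` on `U₀` matter. -/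
structure KVectorField.IsIntegralSection [IsManifold I 1 M] {k : ℕ} (X : KVectorField I M k)
    (U₀ : Set (Euc k)) (φ : Euc k → M) : Prop where
  isOpen : IsOpen U₀
  zero_mem : (0 : Euc k) ∈ U₀
  smooth : ContMDiffOn (𝓡 k) I ∞ φ U₀
  eq : ∀ t ∈ U₀, ∀ A, mfderiv (𝓡 k) I φ t (basisVec A) = X.comp A (φ t)

/-- `X` is integrable at the points of `S`: an integral section of `X` passes through each point of
`S`. -/
def KVectorField.IsIntegrableOn [IsManifold I 1 M] {k : ℕ} (X : KVectorField I M k)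
    (S : Set M) : Prop :=
  ∀ x ∈ S, ∃ (U₀ : Set (Euc k)) (φ : Euc k → M), X.IsIntegralSection U₀ φ ∧ φ 0 = x

end General

section Theory

variable {n k : ℕ} {Q : Type*} [TopologicalSpace Q] [ChartedSpace (Euc n) Q]
  [IsManifold (𝓡 n) ∞ Q]

/-! ### The canonical polysymplectic structure -/

/-- The Liouville 1-forms `(θ₀)_A` on `(T¹ₖ)*Q`: `(θ₀)_A(α)(X) = α^A(τ_* X)`, where
`τ : (T¹ₖ)*Q → Q` is the projection. -/
def liouvilleForm (A : Fin k) (α : Cov n k Q) : TangentSpace (covModel n k) α →L[ℝ] ℝ :=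
  (EuclideanSpace.proj A : Euc k →L[ℝ] ℝ).comp
    (α.2.comp (mfderiv (covModel n k) (𝓡 n) (TotalSpace.proj : Cov n k Q → Q) α))

/-- The canonical 2-forms `(ω₀)_A = -d(θ₀)_A` on `(T¹ₖ)*Q`. -/
def canonicalForm (A : Fin k) (α : Cov n k Q) (X Y : TangentSpace (covModel n k) α) : ℝ :=
  -extDerivOneForm (covModel n k) (liouvilleForm A) α X Y

/-! ### Lagrangian side: Legendre map, energy, regularity -/

/-- The vector `(0, …, w, …, 0)` of the fibre of `T¹ₖQ`, with `w` in the `A`-th place. -/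
def singleVel (q : Q) (A : Fin k) (w : TangentSpace (𝓡 n) q) : VelFiber n k Q q :=
  (EuclideanSpace.proj A : Euc k →L[ℝ] ℝ).smulRight w

/-- The covector `[FL(v)]^A : w ↦ d/ds L(v_1, …, v_A + s w, …, v_k)|_{s = 0}`. -/
def legendreComponent (L : Vel n k Q → ℝ) (v : Vel n k Q) (A : Fin k) : Euc n →L[ℝ] ℝ :=
  fderiv ℝ (fun w : Euc n => L ⟨v.1, v.2 + singleVel v.1 A w⟩) 0

/-- The Legendre map `FL : T¹ₖQ → (T¹ₖ)*Q`. -/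
def legendre (L : Vel n k Q → ℝ) (v : Vel n k Q) : Cov n k Q :=
  ⟨v.1, (∑ A, (legendreComponent L v A).smulRight (basisVec A) : Euc n →L[ℝ] Euc k)⟩

/-- The energy `E_L = C(L) - L`, where `C` is the Liouville vector field, i.e. the infinitesimal
generator of the flow `(s, v) ↦ eˢ v`. -/
def energy (L : Vel n k Q → ℝ) (v : Vel n k Q) : ℝ :=
  deriv (fun s : ℝ => L ⟨v.1, Real.exp s • v.2⟩) 0 - L v

/-- The point of `T¹ₖQ` with coordinates `(q^i, v^i_A) = (x_i, (V e_A)_i)` in the coordinate system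
induced by the chart `e` of `Q`. -/
def velPoint (e : OpenPartialHomeomorph Q (Euc n)) (x : Euc n) (V : Euc k →L[ℝ] Euc n) :
    Vel n k Q :=
  ⟨e.symm x, (mfderiv (𝓡 n) (𝓡 n) e.symm x : Euc n →L[ℝ] TangentSpace (𝓡 n) (e.symm x)).comp V⟩

/-- The coordinate direction of `v^i_A`. -/
def velDir (i : Fin n) (A : Fin k) : Euc k →L[ℝ] Euc n :=
  (EuclideanSpace.proj A : Euc k →L[ℝ] ℝ).smulRight (basisVec i)

/-- The matrix `(∂²L / ∂v^i_A ∂v^j_B)` at the point with coordinates `(x, V)`. -/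
def fiberHessian (L : Vel n k Q → ℝ) (e : OpenPartialHomeomorph Q (Euc n)) (x : Euc n)
    (V : Euc k →L[ℝ] Euc n) : Matrix (Fin n × Fin k) (Fin n × Fin k) ℝ :=
  Matrix.of fun a b =>
    deriv (fun s : ℝ => deriv (fun r : ℝ =>
      L (velPoint e x (V + s • velDir a.1 a.2 + r • velDir b.1 b.2))) 0) 0

/-- `L` is regular: `det (∂²L / ∂v^i_A ∂v^j_B) ≠ 0` everywhere, in all induced coordinates. -/
def IsRegularLagrangian (L : Vel n k Q → ℝ) : Prop :=
  ∀ e ∈ IsManifold.maximalAtlas (𝓡 n) ∞ Q, ∀ x ∈ e.target, ∀ V : Euc k →L[ℝ] Euc n,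
    (fiberHessian L e x V).det ≠ 0

/-! ### The unified formalism -/

/-- The projection `pr₁ : T¹ₖQ ⊕ (T¹ₖ)*Q → T¹ₖQ`. -/
def pr₁ (z : Whitney n k Q) : Vel n k Q := ⟨z.1, z.2.1⟩

/-- The projection `pr₂ : T¹ₖQ ⊕ (T¹ₖ)*Q → (T¹ₖ)*Q`. -/
def pr₂ (z : Whitney n k Q) : Cov n k Q := ⟨z.1, z.2.2⟩

/-- The 2-forms `Ω_A = (pr₂)^* (ω₀)_A`. -/
def unifiedForm (A : Fin k) (z : Whitney n k Q) (X Y : TangentSpace (whitneyModel n k) z) : ℝ :=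
  canonicalForm A (pr₂ z)
    (mfderiv (whitneyModel n k) (covModel n k) (pr₂ (n := n) (k := k) (Q := Q)) z X)
    (mfderiv (whitneyModel n k) (covModel n k) (pr₂ (n := n) (k := k) (Q := Q)) z Y)

/-- The coupling function `𝒞(v, α) = ∑_A α^A(v_A)`. -/
def coupling (z : Whitney n k Q) : ℝ :=
  ∑ A : Fin k, (z.2.2 (z.2.1 (basisVec A)) : Euc k) A

/-- The Hamiltonian function `ℋ = 𝒞 - pr₁^* L`. -/
def unifiedHamiltonian (L : Vel n k Q → ℝ) (z : Whitney n k Q) : ℝ :=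
  coupling z - L (pr₁ z)

/-- `Z` satisfies the equation `∑_A ι_{Z_A} Ω_A = dℋ` at the point `z`. -/
def SolvesUnifiedAt (L : Vel n k Q → ℝ)
    (Z : KVectorField (whitneyModel n k) (Whitney n k Q) k) (z : Whitney n k Q) : Prop :=
  ∀ Y : TangentSpace (whitneyModel n k) z,
    ∑ A, unifiedForm A z (Z.comp A z) Y =
      mfderiv (whitneyModel n k) 𝓘(ℝ, ℝ) (unifiedHamiltonian L) z Y

/-- The submanifold `M_L`, given by `p^A_i = ∂L/∂v^i_A`, i.e. the graph of the Legendre map. -/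
def legendreGraph (L : Vel n k Q → ℝ) : Set (Whitney n k Q) :=
  {z | pr₂ z = legendre L (pr₁ z)}

/-! ### The Hamilton–De Donder–Weyl field equations -/

/-- The point of `(T¹ₖ)*Q` with coordinates `(q^i, p^A_i) = (x_i, (P e_i)_A)` in the coordinate
system induced by the chart `e` of `Q`. -/
def covPoint (e : OpenPartialHomeomorph Q (Euc n)) (x : Euc n) (P : Euc n →L[ℝ] Euc k) :
    Cov n k Q :=
  ⟨e.symm x, P.comp (mfderiv (𝓡 n) (𝓡 n) e (e.symm x) : _ →L[ℝ] Euc n)⟩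

/-- The coordinate direction of `p^A_i`. -/
def covDir (A : Fin k) (i : Fin n) : Euc n →L[ℝ] Euc k :=
  (EuclideanSpace.proj i : Euc n →L[ℝ] ℝ).smulRight (basisVec A)

/-- The coordinates `q^i(α)`, as a vector of `ℝⁿ`. -/
def coordQ (e : OpenPartialHomeomorph Q (Euc n)) (α : Cov n k Q) : Euc n := e α.1

/-- The coordinates `p^A_i(α) = α^A(∂/∂q^i)`, as the linear map `P` with `(P e_i)_A = p^A_i(α)`. -/
def coordP (e : OpenPartialHomeomorph Q (Euc n)) (α : Cov n k Q) : Euc n →L[ℝ] Euc k :=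
  (show Euc n →L[ℝ] Euc k from α.2).comp (mfderiv (𝓡 n) (𝓡 n) e.symm (e α.1) : _ →L[ℝ] Euc n)

/-- `∂H/∂q^i` at `α`, in the coordinates induced by `e`. -/
def partialQ (e : OpenPartialHomeomorph Q (Euc n)) (H : Cov n k Q → ℝ) (i : Fin n)
    (α : Cov n k Q) : ℝ :=
  deriv (fun s : ℝ => H (covPoint e (coordQ e α + s • basisVec i) (coordP e α))) 0

/-- `∂H/∂p^A_i` at `α`, in the coordinates induced by `e`. -/
def partialP (e : OpenPartialHomeomorph Q (Euc n)) (H : Cov n k Q → ℝ) (A : Fin k) (i : Fin n)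
    (α : Cov n k Q) : ℝ :=
  deriv (fun s : ℝ => H (covPoint e (coordQ e α) (coordP e α + s • covDir A i))) 0

/-- `φ : V ⊆ ℝᵏ → (T¹ₖ)*Q` is a solution on the open set `V` of the Hamilton–De Donder–Weyl field
equations
`∂H/∂q^i = -∑_A ∂φ^A_i/∂t^A`, `∂H/∂p^A_i = ∂φ^i/∂t^A`
for the Hamiltonian `H`, in all local coordinates `(q^i, p^A_i)` induced by charts of `Q`. The map
`φ` and, near the values of `φ`, the function `H` are smooth. -/
structure IsHDWSolution (H : Cov n k Q → ℝ) (V : Set (Euc k)) (φ : Euc k → Cov n k Q) :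
    Prop where
  isOpen : IsOpen V
  smooth : ContMDiffOn (𝓡 k) (covModel n k) ∞ φ V
  smooth_hamiltonian : ∀ t ∈ V, ContMDiffAt (covModel n k) 𝓘(ℝ, ℝ) ∞ H (φ t)
  eq_q : ∀ e ∈ IsManifold.maximalAtlas (𝓡 n) ∞ Q, ∀ t ∈ V, (φ t).1 ∈ e.source → ∀ i : Fin n,
    partialQ e H i (φ t) =
      -∑ A, lineDeriv ℝ (fun t' => coordP e (φ t') (basisVec i) A) t (basisVec A)
  eq_p : ∀ e ∈ IsManifold.maximalAtlas (𝓡 n) ∞ Q, ∀ t ∈ V, (φ t).1 ∈ e.source →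
    ∀ (A : Fin k) (i : Fin n),
    partialP e H A i (φ t) = lineDeriv ℝ (fun t' => coordQ e (φ t') i) t (basisVec A)

end Theory

end KSymplectic

end

namespace KSymplectic

/-! ### Legendre transformation in vector spaces -/

section Calculus

variable {X V P : Type*} [NormedAddCommGroup X] [NormedSpace ℝ X] [NormedAddCommGroup V]
  [NormedSpace ℝ V] [NormedAddCommGroup P] [NormedSpace ℝ P]

/-! Everything happens in the coordinates `(q, v, p)` induced by an arbitrary chart of `Q`. There
`Ω_A = ∑_i dq^i ∧ dp^A_i` and `ℋ = p·v - L(q, v)`. Testing `∑_A ι_{Z_A} Ω_A = dℋ` on vectors without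
velocity component (`SolvesUnifiedAt.eq_coord`) shows that along an integral section `∂q^i/∂t^A =
v^i_A` and `∑_A ∂p^A_i/∂t^A = ∂L/∂q^i` (`sum_lineDeriv_integralSection`). The velocity components of
the equation would only give `p = ∂L/∂v`, which already holds on `M_L`.

On the other side, regularity makes the second fibre derivative of `L` non-degenerate, so by the
inverse function theorem `FL`, which is `(q, v) ↦ (q, ∂L/∂v)` in coordinates, is a local
diffeomorphism (`exists_localLegendre_inverse`). Near a point of `FL(U)` a function `H` with `H ∘ FL
= E_L` is therefore `E_L ∘ FL⁻¹`, hence smooth (`contMDiffAt_of_comp_legendre`). Differentiating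
`H(q, ∂L/∂v) = v·∂L/∂v - L(q, v)`, the terms containing `dv` on the right cancel, as in the
classical Legendre transformation, and what remains is `∂H/∂p = v`, `∂H/∂q = -∂L/∂q`
(`fderiv_hamiltonian`, `partialP_and_partialQ_eq`).

Since `ψ` takes values in the graph of `FL`, `ψ_H = pr₂ ∘ ψ`, and comparing the two sets of formulas
gives the Hamilton–De Donder–Weyl equations. -/

/-- The derivative of `l` in the direction of the velocities, as a momentum; `m` identifies linear
forms on the space `V` of velocities with elements of the space `P` of momenta. -/
noncomputable def fiberDeriv (m : (V →L[ℝ] ℝ) →L[ℝ] P) (l : X × V → ℝ) (y : X × V) : P :=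
  m ((fderiv ℝ l y).comp (ContinuousLinearMap.inr ℝ X V))

/-- The Legendre map of `l` in coordinates. -/
noncomputable def localLegendre (m : (V →L[ℝ] ℝ) →L[ℝ] P) (l : X × V → ℝ) (y : X × V) : X × P :=
  (y.1, fiberDeriv m l y)

/-- The energy of `l` in coordinates. -/
noncomputable def localEnergy (l : X × V → ℝ) (y : X × V) : ℝ :=
  fderiv ℝ l y (0, y.2) - l y

/-- Non-degeneracy of the second fibre derivative. -/
def IsNondegenerateAt (l : X × V → ℝ) (y : X × V) : Prop :=
  ∀ W : V, (∀ W' : V, fderiv ℝ (fderiv ℝ l) y (0, W) (0, W') = 0) → W = 0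

variable (m : (V →L[ℝ] ℝ) →L[ℝ] P) {l : X × V → ℝ} {y₀ : X × V}

theorem _root_.ContDiffAt.fiberDeriv (hl : ContDiffAt ℝ ∞ l y₀) :
    ContDiffAt ℝ ∞ (fiberDeriv m l) y₀ := by
  have h : ContDiffAt ℝ ∞ (fderiv ℝ l) y₀ := hl.fderiv_right (by simp)
  exact m.contDiff.contDiffAt.comp y₀ (h.clm_comp contDiffAt_const)

theorem _root_.ContDiffAt.localLegendre (hl : ContDiffAt ℝ ∞ l y₀) :
    ContDiffAt ℝ ∞ (localLegendre m l) y₀ :=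
  contDiffAt_fst.prodMk (hl.fiberDeriv m)

theorem _root_.ContDiffAt.localEnergy (hl : ContDiffAt ℝ ∞ l y₀) :
    ContDiffAt ℝ ∞ (localEnergy l) y₀ := by
  have h : ContDiffAt ℝ ∞ (fderiv ℝ l) y₀ := hl.fderiv_right (by simp)
  exact (h.clm_apply (contDiffAt_const.prodMk contDiffAt_snd)).sub hl

theorem fderiv_localLegendre (hl : ContDiffAt ℝ ∞ l y₀) (η : X × V) :
    fderiv ℝ (localLegendre m l) y₀ η = (η.1, fderiv ℝ (fiberDeriv m l) y₀ η) := by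
  have h := (hasFDerivAt_fst (𝕜 := ℝ) (p := y₀)).prodMk
    ((hl.fiberDeriv m).differentiableAt (by simp)).hasFDerivAt
  have h' : fderiv ℝ (localLegendre m l) y₀ = _ := h.fderiv
  rw [h']; rfl

variable {m} {B : P →L[ℝ] V →L[ℝ] ℝ}

/-- The hypothesis `hB` says that `B` evaluates the linear form represented by a momentum. The
abstract `m` and `B` are later taken to be `momentum` and `pairing`; `pairing_momentum` supplies
`hB`. -/
theorem pairing_fiberDeriv (hB : ∀ f W, B (m f) W = f W) (y : X × V) (W : V) :
    B (fiberDeriv m l y) W = fderiv ℝ l y (0, W) := by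
  simp [fiberDeriv, hB]

/-- Differentiating `pairing_fiberDeriv` in `y` with `W` fixed expresses the vertical part of the
derivative of the Legendre map through the Hessian of `l`. -/
theorem pairing_fderiv_fiberDeriv (hB : ∀ f W, B (m f) W = f W) (hl : ContDiffAt ℝ ∞ l y₀)
    (η : X × V) (W : V) :
    B (fderiv ℝ (fiberDeriv m l) y₀ η) W = fderiv ℝ (fderiv ℝ l) y₀ η (0, W) := by
  have h : DifferentiableAt ℝ (fderiv ℝ l) y₀ :=
    (hl.fderiv_right (m := ∞) (by simp)).differentiableAt (by simp)
  have h1 : HasFDerivAt (fun y => B (fiberDeriv m l y) W)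
      ((B.flip W).comp (fderiv ℝ (fiberDeriv m l) y₀)) y₀ :=
    (B.flip W).hasFDerivAt.comp y₀ ((hl.fiberDeriv m).differentiableAt (by simp)).hasFDerivAt
  have h2 : HasFDerivAt (fun y => B (fiberDeriv m l y) W)
      ((ContinuousLinearMap.apply ℝ ℝ ((0 : X), W)).comp (fderiv ℝ (fderiv ℝ l) y₀)) y₀ := by
    simp_rw [pairing_fiberDeriv hB]
    exact (ContinuousLinearMap.apply ℝ ℝ ((0 : X), W)).hasFDerivAt.comp y₀ h.hasFDerivAt
  exact congrArg (fun f => f η) (h1.unique h2)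

/-- The derivative of the local Legendre map is an isomorphism. -/
theorem exists_equiv_fderiv_localLegendre [FiniteDimensional ℝ X] [FiniteDimensional ℝ V]
    [FiniteDimensional ℝ P] (hdim : Module.finrank ℝ V = Module.finrank ℝ P)
    (hB : ∀ f W, B (m f) W = f W) (hl : ContDiffAt ℝ ∞ l y₀) (hreg : IsNondegenerateAt l y₀) :
    ∃ D : (X × V) ≃L[ℝ] (X × P), (D : X × V →L[ℝ] X × P) = fderiv ℝ (localLegendre m l) y₀ := by
  have hinj : Function.Injective (fderiv ℝ (localLegendre m l) y₀).toLinearMap := by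
    rw [← LinearMap.ker_eq_bot, LinearMap.ker_eq_bot']
    rintro ⟨ξ, W⟩ h
    replace h : fderiv ℝ (localLegendre m l) y₀ (ξ, W) = 0 := h
    rw [fderiv_localLegendre m hl, Prod.mk_eq_zero] at h
    obtain ⟨rfl, h⟩ := h
    -- The base component of the kernel vector vanishes because the local Legendre map preserves the
    -- base point; its vertical component `W` is then in the radical of the fibre Hessian.
    have : W = 0 := hreg W fun W' => by rw [← pairing_fderiv_fiberDeriv hB hl, h]; simp
    rw [this]; rfl
  have hdim' : Module.finrank ℝ (X × V) = Module.finrank ℝ (X × P) := by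
    rw [Module.finrank_prod, Module.finrank_prod, hdim]
  exact ⟨(LinearEquiv.ofInjectiveOfFinrankEq _ hinj hdim').toContinuousLinearEquiv,
    ContinuousLinearMap.ext fun _ => rfl⟩

/-- The derivatives of the Hamiltonian function that corresponds to the Lagrangian `l`. -/
theorem fderiv_hamiltonian [FiniteDimensional ℝ X] [FiniteDimensional ℝ V]
    [FiniteDimensional ℝ P] (hdim : Module.finrank ℝ V = Module.finrank ℝ P)
    (hB : ∀ f W, B (m f) W = f W) (hl : ContDiffAt ℝ ∞ l y₀) (hreg : IsNondegenerateAt l y₀)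
    {h : X × P → ℝ} (hh : DifferentiableAt ℝ h (localLegendre m l y₀))
    (heq : ∀ᶠ y in 𝓝 y₀, h (localLegendre m l y) = localEnergy l y) (ξ : X) (R : P) :
    fderiv ℝ h (localLegendre m l y₀) (ξ, R) = B R y₀.2 - fderiv ℝ l y₀ (ξ, 0) := by
  -- The derivative of the Legendre map is onto, so every direction `(ξ, R)` is the image of some
  -- `(ξ', W)` and the chain rule for `h ∘ localLegendre` determines `fderiv ℝ h`.
  obtain ⟨D, hD⟩ := exists_equiv_fderiv_localLegendre hdim hB hl hreg
  obtain ⟨⟨ξ', W⟩, hη⟩ := D.surjective (ξ, R)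
  replace hη : fderiv ℝ (localLegendre m l) y₀ (ξ', W) = (ξ, R) := by rw [← hD]; exact hη
  have hη' := hη
  rw [fderiv_localLegendre m hl, Prod.mk.injEq] at hη'
  obtain ⟨h1, h2⟩ := hη'
  dsimp only at h1
  subst h1
  have hdF := ((hl.fiberDeriv m).differentiableAt (by simp)).hasFDerivAt
  have hdG := ((hl.localLegendre m).differentiableAt (by simp)).hasFDerivAt
  have hE₀ : localEnergy l = fun y => B (fiberDeriv m l y) y.2 - l y := by
    ext y; rw [pairing_fiberDeriv hB]; rfl
  have hF := B.hasFDerivAt.comp y₀ hdF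
  have hE := (hF.clm_apply (hasFDerivAt_snd (𝕜 := ℝ) (p := y₀))).sub
    (hl.differentiableAt (by simp)).hasFDerivAt
  have hC := hh.hasFDerivAt.comp y₀ hdG
  rw [hE₀] at heq
  have key := congrArg (fun f => f (ξ', W)) ((hC.congr_of_eventuallyEq
    (heq.mono fun _ h => h.symm)).unique hE)
  change fderiv ℝ h (localLegendre m l y₀) (fderiv ℝ (localLegendre m l) y₀ (ξ', W)) =
    B (fiberDeriv m l y₀) W + B (fderiv ℝ (fiberDeriv m l) y₀ (ξ', W)) y₀.2 -
      fderiv ℝ l y₀ (ξ', W) at key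
  rw [hη, h2, pairing_fiberDeriv hB] at key
  -- The contribution of `W` to `dl` cancels against the pairing of the momentum with `W`, so the
  -- unknown lift `W` disappears.
  rw [key, show ((ξ', W) : X × V) = (ξ', 0) + (0, W) by simp, map_add]
  ring

/-- The local Legendre map as a local diffeomorphism. -/
theorem exists_localLegendre_inverse [FiniteDimensional ℝ X] [FiniteDimensional ℝ V]
    [FiniteDimensional ℝ P] (hdim : Module.finrank ℝ V = Module.finrank ℝ P)
    (hB : ∀ f W, B (m f) W = f W) (hl : ContDiffAt ℝ ∞ l y₀) (hreg : IsNondegenerateAt l y₀) :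
    ∃ g : OpenPartialHomeomorph (X × V) (X × P), y₀ ∈ g.source ∧ ⇑g = localLegendre m l ∧
      ContDiffAt ℝ ∞ g.symm (localLegendre m l y₀) := by
  have := FiniteDimensional.complete ℝ (X × V)
  obtain ⟨D, hD⟩ := exists_equiv_fderiv_localLegendre hdim hB hl hreg
  have hd : HasFDerivAt (localLegendre m l) (D : X × V →L[ℝ] X × P) y₀ := by
    rw [hD]; exact ((hl.localLegendre m).differentiableAt (by simp)).hasFDerivAt
  exact ⟨(hl.localLegendre m).toOpenPartialHomeomorph _ hd (by simp),
    (hl.localLegendre m).mem_toOpenPartialHomeomorph_source hd (by simp),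
    (hl.localLegendre m).toOpenPartialHomeomorph_coe hd (by simp),
    (hl.localLegendre m).to_localInverse hd (by simp)⟩

theorem hasDerivAt_line (x : X) (W' W : V) (s : ℝ) :
    HasDerivAt (fun r : ℝ => (x, W' + r • W)) (0, W) s := by
  have : HasDerivAt (fun r : ℝ => W' + r • W) W s := by
    simpa using ((hasDerivAt_id s).smul_const W).const_add W'
  exact (hasDerivAt_const s x).prodMk this

theorem deriv_line_snd {h : X × V → ℝ} {x : X} {v : V} (hh : DifferentiableAt ℝ h (x, v)) (W : V) :
    deriv (fun s : ℝ => h (x, v + s • W)) 0 = fderiv ℝ h (x, v) (0, W) := by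
  have h' : HasFDerivAt h (fderiv ℝ h (x, v)) (x, v + (0 : ℝ) • W) := by
    rw [zero_smul, add_zero]; exact hh.hasFDerivAt
  exact (h'.comp_hasDerivAt (0 : ℝ) (hasDerivAt_line x v W 0)).deriv

theorem deriv_line_fst {h : X × V → ℝ} {x : X} {v : V} (hh : DifferentiableAt ℝ h (x, v)) (ξ : X) :
    deriv (fun s : ℝ => h (x + s • ξ, v)) 0 = fderiv ℝ h (x, v) (ξ, 0) := by
  have h' : HasFDerivAt h (fderiv ℝ h (x, v)) (x + (0 : ℝ) • ξ, v) := by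
    rw [zero_smul, add_zero]; exact hh.hasFDerivAt
  have hline : HasDerivAt (fun s : ℝ => (x + s • ξ, v)) (ξ, 0) 0 := by
    have : HasDerivAt (fun s : ℝ => x + s • ξ) ξ 0 := by
      simpa using ((hasDerivAt_id (0 : ℝ)).smul_const ξ).const_add x
    exact this.prodMk (hasDerivAt_const (0 : ℝ) v)
  exact (h'.comp_hasDerivAt (0 : ℝ) hline).deriv

/-- Translates the iterated one-variable derivatives that define `fiberHessian` into the second
Fréchet derivative used in `IsNondegenerateAt`. -/
theorem deriv_deriv_eq_fderiv_fderiv (hl : ContDiffAt ℝ ∞ l y₀) (W W' : V) :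
    deriv (fun s : ℝ => deriv (fun r : ℝ => l (y₀.1, y₀.2 + s • W + r • W')) 0) 0 =
      fderiv ℝ (fderiv ℝ l) y₀ (0, W) (0, W') := by
  obtain ⟨x, v⟩ := y₀
  dsimp only
  have hev : ∀ᶠ y in 𝓝 (x, v), DifferentiableAt ℝ l y := by
    filter_upwards [(hl.of_le (m := 1) (by simp)).eventually (by simp)] with y hy
    exact hy.differentiableAt (by simp)
  have hc : Filter.Tendsto (fun s : ℝ => (x, v + s • W)) (𝓝 0) (𝓝 (x, v)) := by
    simpa [ContinuousAt] using (hasDerivAt_line x v W 0).continuousAt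
  have h1 : (fun s : ℝ => deriv (fun r : ℝ => l (x, v + s • W + r • W')) 0) =ᶠ[𝓝 0]
      fun s => fderiv ℝ l (x, v + s • W) (0, W') := by
    filter_upwards [hc.eventually hev] with s hs
    have hs' : HasFDerivAt l (fderiv ℝ l (x, v + s • W)) (x, v + s • W + (0 : ℝ) • W') := by
      simpa using hs.hasFDerivAt
    exact (hs'.comp_hasDerivAt (0 : ℝ) (hasDerivAt_line x (v + s • W) W' 0)).deriv
  rw [h1.deriv_eq]
  have h : HasFDerivAt (fderiv ℝ l) (fderiv ℝ (fderiv ℝ l) (x, v)) (x, v + (0 : ℝ) • W) := by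
    simpa using ((hl.fderiv_right (m := ∞) (by simp)).differentiableAt (by simp)).hasFDerivAt
  have h2 := (ContinuousLinearMap.apply ℝ ℝ ((0 : X), W')).hasFDerivAt.comp_hasDerivAt
    (0 : ℝ) (h.comp_hasDerivAt (0 : ℝ) (hasDerivAt_line x v W 0))
  exact h2.deriv

/-- Non-degeneracy from the non-vanishing of the determinant of the fibre Hessian. -/
theorem isNondegenerateAt_of_det {ι : Type*} [Fintype ι] [DecidableEq ι] (b : ι → V) (c : V → ι → ℝ)
    (hb : ∀ W, ∑ i, c W i • b i = W) (hl : ContDiffAt ℝ ∞ l y₀)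
    (hdet : (Matrix.of fun i j : ι => deriv (fun s : ℝ => deriv (fun r : ℝ =>
      l (y₀.1, y₀.2 + s • b i + r • b j)) 0) 0).det ≠ 0) :
    IsNondegenerateAt l y₀ := by
  simp_rw [deriv_deriv_eq_fderiv_fderiv hl] at hdet
  intro W hW
  -- Testing `hW` on the vectors `b j` shows that the coefficient vector of `W` is a left null
  -- vector of the Hessian.
  have hzero := Matrix.eq_zero_of_vecMul_eq_zero hdet (v := c W) (by
    ext j
    simp only [Matrix.vecMul, dotProduct, Matrix.of_apply, Pi.zero_apply]
    rw [← hW (b j)]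
    conv_rhs => rw [← hb W]
    have h : ∀ Y : V, ((0 : X), Y) = ContinuousLinearMap.inr ℝ X V Y := fun _ => rfl
    rw [h (∑ i, _), map_sum, map_sum, sum_apply]
    refine Finset.sum_congr rfl fun i _ => ?_
    rw [map_smul, map_smul, smul_apply, smul_eq_mul]
    rfl)
  rw [← hb W]
  simp [hzero]

/-- This is `dℋ` in coordinates, on directions with zero velocity component only; these are the
directions from which the field equations are read off. -/
theorem fderiv_pairing_sub (B : P →L[ℝ] V →L[ℝ] ℝ) {y : X × (V × P)}
    (hl : DifferentiableAt ℝ l (y.1, y.2.1)) (ξ : X) (R : P) :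
    fderiv ℝ (fun y : X × (V × P) => B y.2.2 y.2.1 - l (y.1, y.2.1)) y (ξ, 0, R) =
      B R y.2.1 - fderiv ℝ l (y.1, y.2.1) (ξ, 0) := by
  have h1 := ((ContinuousLinearMap.fst ℝ V P).comp
    (ContinuousLinearMap.snd ℝ X (V × P))).hasFDerivAt (x := y)
  have h2 := ((ContinuousLinearMap.snd ℝ V P).comp
    (ContinuousLinearMap.snd ℝ X (V × P))).hasFDerivAt (x := y)
  have h4 := hl.hasFDerivAt.comp y ((hasFDerivAt_fst (𝕜 := ℝ) (p := y)).prodMk h1)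
  have h5 := (B.hasFDerivAt.comp y h2).clm_apply h1
  refine (congrArg (fun D => D (ξ, 0, R)) (h5.sub h4).fderiv).trans ?_
  change (B y.2.2 0 + B R y.2.1) - _ = _
  rw [map_zero, zero_add]
  rfl

end Calculus

/-! ### Velocities and momenta -/

section Pairing

variable {n k : ℕ}

/-- The inclusion `w ↦ (0, …, w, …, 0)` of the `A`-th factor of the space of velocities. -/
noncomputable def inclVel (n : ℕ) {k : ℕ} (A : Fin k) : Euc n →L[ℝ] Euc k →L[ℝ] Euc n :=
  ContinuousLinearMap.smulRightL ℝ (Euc k) (Euc n) (EuclideanSpace.proj A : Euc k →L[ℝ] ℝ)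

@[simp] theorem inclVel_apply (A : Fin k) (w : Euc n) :
    inclVel n A w = (EuclideanSpace.proj A : Euc k →L[ℝ] ℝ).smulRight w := rfl

theorem sum_inclVel (V : Euc k →L[ℝ] Euc n) : ∑ A, inclVel n A (V (basisVec A)) = V := by
  ext x i
  have hx : x = ∑ A, x A • (basisVec A : Euc k) := by
    ext B; simp [Finset.sum_apply, Pi.single_apply]
  conv_rhs => rw [hx]
  simp

/-- The trace of an endomorphism of `ℝᵏ`, as a continuous linear form. -/
noncomputable def traceForm (k : ℕ) : (Euc k →L[ℝ] Euc k) →L[ℝ] ℝ :=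
  ∑ A : Fin k, (EuclideanSpace.proj A : Euc k →L[ℝ] ℝ).comp
    (ContinuousLinearMap.apply ℝ (Euc k) (basisVec A))

theorem traceForm_apply (T : Euc k →L[ℝ] Euc k) : traceForm k T = ∑ A, T (basisVec A) A := by
  rw [traceForm, FunLike.coe_sum, Finset.sum_apply]
  rfl

/-- The pairing `(P, V) ↦ ∑_A (P (V e_A))_A` between momenta and velocities. -/
noncomputable def pairing (n k : ℕ) : (Euc n →L[ℝ] Euc k) →L[ℝ] (Euc k →L[ℝ] Euc n) →L[ℝ] ℝ :=
  (ContinuousLinearMap.compL ℝ (Euc k →L[ℝ] Euc n) (Euc k →L[ℝ] Euc k) ℝ (traceForm k)).comp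
    (ContinuousLinearMap.compL ℝ (Euc k) (Euc n) (Euc k))

theorem pairing_apply (P : Euc n →L[ℝ] Euc k) (V : Euc k →L[ℝ] Euc n) :
    pairing n k P V = ∑ A : Fin k, P (V (basisVec A)) A :=
  traceForm_apply (P.comp V)

set_option synthInstance.maxHeartbeats 200000 in
/-- The momentum that represents a linear form on the space of velocities. -/
noncomputable def momentum (n k : ℕ) : ((Euc k →L[ℝ] Euc n) →L[ℝ] ℝ) →L[ℝ] (Euc n →L[ℝ] Euc k) :=
  ∑ A : Fin k, ((ContinuousLinearMap.smulRightL ℝ (Euc n) (Euc k)).flip (basisVec A)).comp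
    ((ContinuousLinearMap.compL ℝ (Euc n) (Euc k →L[ℝ] Euc n) ℝ).flip (inclVel n A))

theorem momentum_eq (l : (Euc k →L[ℝ] Euc n) →L[ℝ] ℝ) :
    momentum n k l = ∑ A : Fin k, (l.comp (inclVel n A)).smulRight (basisVec A) := by
  rw [momentum, FunLike.coe_sum, Finset.sum_apply]
  rfl

theorem momentum_apply (l : (Euc k →L[ℝ] Euc n) →L[ℝ] ℝ) (w : Euc n) (A : Fin k) :
    momentum n k l w A = l (inclVel n A w) := by
  simp [momentum_eq, Finset.sum_apply, Pi.single_apply]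

theorem pairing_momentum (l : (Euc k →L[ℝ] Euc n) →L[ℝ] ℝ) (V : Euc k →L[ℝ] Euc n) :
    pairing n k (momentum n k l) V = l V := by
  rw [pairing_apply]
  simp_rw [momentum_apply]
  rw [← map_sum, sum_inclVel]

theorem pairing_zero_left (V : Euc k →L[ℝ] Euc n) : pairing n k 0 V = 0 := by
  rw [pairing_apply]
  exact Finset.sum_eq_zero fun A _ => rfl

theorem sum_velDir (W : Euc k →L[ℝ] Euc n) :
    ∑ a : Fin n × Fin k, W (basisVec a.2) a.1 • velDir (n := n) (k := k) a.1 a.2 = W := by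
  rw [Fintype.sum_prod_type_right]
  conv_rhs => rw [← sum_inclVel W]
  refine Finset.sum_congr rfl fun A _ => ?_
  ext y j
  simp [velDir, Finset.sum_apply, Pi.single_apply, mul_comm]

theorem finrank_vel_eq_finrank_cov :
    Module.finrank ℝ (Euc k →L[ℝ] Euc n) = Module.finrank ℝ (Euc n →L[ℝ] Euc k) := by
  have h : ∀ a b : ℕ, Module.finrank ℝ (Euc a →L[ℝ] Euc b) = a * b := fun a b => by
    rw [← (LinearMap.toContinuousLinearMap (𝕜 := ℝ) (E := Euc a) (F' := Euc b)).finrank_eq,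
      Module.finrank_linearMap]
    simp
  rw [h, h, mul_comm]

end Pairing

/-! ### Induced coordinates -/

section Coord

variable {n k : ℕ} {Q : Type*} [TopologicalSpace Q] [ChartedSpace (Euc n) Q]

/-- The derivative of a chart, as an endomorphism of the model space. -/
noncomputable def chartDeriv (e : OpenPartialHomeomorph Q (Euc n)) (q : Q) : Euc n →L[ℝ] Euc n :=
  mfderiv (𝓡 n) (𝓡 n) e q

/-- The derivative of the inverse of a chart, as an endomorphism of the model space. -/
noncomputable def symmDeriv (e : OpenPartialHomeomorph Q (Euc n)) (x : Euc n) :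
    Euc n →L[ℝ] Euc n :=
  mfderiv (𝓡 n) (𝓡 n) e.symm x

variable {e : OpenPartialHomeomorph Q (Euc n)}

/-- All tangent spaces are definitionally the model space. Treating both derivatives as
endomorphisms of `Euc n` allows composition without transport between base points that are equal
only propositionally. -/
theorem chartDeriv_comp_symmDeriv (he : e ∈ IsManifold.maximalAtlas (𝓡 n) ∞ Q)
    {x : Euc n} (hx : x ∈ e.target) :
    (chartDeriv e (e.symm x)).comp (symmDeriv e x) = ContinuousLinearMap.id ℝ (Euc n) := by
  have h1 : MDifferentiableAt (𝓡 n) (𝓡 n) e (e.symm x) :=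
    ((contMDiffOn_of_mem_maximalAtlas he).contMDiffAt
      (e.open_source.mem_nhds (e.map_target hx))).mdifferentiableAt (by simp)
  have h2 : MDifferentiableAt (𝓡 n) (𝓡 n) e.symm x :=
    ((contMDiffOn_symm_of_mem_maximalAtlas he).contMDiffAt
      (e.open_target.mem_nhds hx)).mdifferentiableAt (by simp)
  refine (mfderiv_comp x h1 h2).symm.trans ?_
  have h : e ∘ e.symm =ᶠ[𝓝 x] id := e.eventually_right_inverse hx
  rw [h.mfderiv_eq]
  exact mfderiv_id

theorem symmDeriv_comp_chartDeriv (he : e ∈ IsManifold.maximalAtlas (𝓡 n) ∞ Q)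
    {q : Q} (hq : q ∈ e.source) :
    (symmDeriv e (e q)).comp (chartDeriv e q) = ContinuousLinearMap.id ℝ (Euc n) := by
  have h2 : MDifferentiableAt (𝓡 n) (𝓡 n) e q :=
    ((contMDiffOn_of_mem_maximalAtlas he).contMDiffAt
      (e.open_source.mem_nhds hq)).mdifferentiableAt (by simp)
  have h1 : MDifferentiableAt (𝓡 n) (𝓡 n) e.symm (e q) :=
    ((contMDiffOn_symm_of_mem_maximalAtlas he).contMDiffAt
      (e.open_target.mem_nhds (e.map_source hq))).mdifferentiableAt (by simp)
  refine (mfderiv_comp q h1 h2).symm.trans ?_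
  have h : e.symm ∘ e =ᶠ[𝓝 q] id := e.eventually_left_inverse hq
  rw [h.mfderiv_eq]
  exact mfderiv_id

theorem contMDiffAt_chart_symm_fst {F : Type*} [NormedAddCommGroup F] [NormedSpace ℝ F]
    (he : e ∈ IsManifold.maximalAtlas (𝓡 n) ∞ Q)
    {y₀ : Euc n × F} (hy₀ : y₀.1 ∈ e.target) :
    ContMDiffAt 𝓘(ℝ, Euc n × F) (𝓡 n) ∞ (fun y => e.symm y.1) y₀ := by
  have h1 : ContMDiffAt 𝓘(ℝ, Euc n × F) (𝓡 n) ∞ (fun y : Euc n × F => y.1) y₀ :=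
    contDiffAt_fst.contMDiffAt
  exact ((contMDiffOn_symm_of_mem_maximalAtlas he).contMDiffAt
    (e.open_target.mem_nhds hy₀)).comp y₀ h1

variable [IsManifold (𝓡 n) ∞ Q]

/-- The coordinates of tangent vectors at `q` in the preferred chart at `q₀`. -/
noncomputable def tangentCoord (q₀ q : Q) : Euc n →L[ℝ] Euc n :=
  (trivializationAt (Euc n) (TangentSpace (𝓡 n)) q₀).continuousLinearMapAt ℝ q

/-- The inverse of the coordinates of tangent vectors at `q` in the preferred chart at `q₀`. -/
noncomputable def tangentCoordSymm (q₀ q : Q) : Euc n →L[ℝ] Euc n :=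
  (trivializationAt (Euc n) (TangentSpace (𝓡 n)) q₀).symmL ℝ q

theorem tangentCoordSymm_comp_tangentCoord {q₀ q : Q}
    (hq : q ∈ (trivializationAt (Euc n) (TangentSpace (𝓡 n)) q₀).baseSet) :
    (tangentCoordSymm q₀ q).comp (tangentCoord q₀ q) = ContinuousLinearMap.id ℝ (Euc n) :=
  ContinuousLinearMap.ext fun w =>
    (trivializationAt (Euc n) (TangentSpace (𝓡 n)) q₀).symmL_continuousLinearMapAt hq w

/-- The trivial factor of the hom bundle contributes the identity, so only the trivialization of the
tangent bundle remains. -/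
theorem inCoordinates_velFiber (q₀ q : Q) (v : VelFiber n k Q q) :
    ContinuousLinearMap.inCoordinates (Euc k) (Bundle.Trivial Q (Euc k)) (Euc n)
      (TangentSpace (𝓡 n)) q₀ q q₀ q v =
      (tangentCoord q₀ q).comp (show Euc k →L[ℝ] Euc n from v) := by
  ext1 w
  simp [ContinuousLinearMap.inCoordinates, tangentCoord]
  rfl

theorem inCoordinates_covFiber (q₀ q : Q) (α : CovFiber n k Q q) :
    ContinuousLinearMap.inCoordinates (Euc n) (TangentSpace (𝓡 n)) (Euc k)
      (Bundle.Trivial Q (Euc k)) q₀ q q₀ q α =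
      (show Euc n →L[ℝ] Euc k from α).comp (tangentCoordSymm q₀ q) := by
  ext1 w
  simp [ContinuousLinearMap.inCoordinates, tangentCoordSymm]
  rfl

/-- The bundle structure uses preferred charts, the field equations arbitrary ones. The two are
linked by the smoothness of the derivative of `e.symm` in tangent coordinates; on the model space
these coordinates are trivial, so a single trivialization factor survives. -/
theorem contMDiffAt_tangentCoord_comp_symmDeriv (he : e ∈ IsManifold.maximalAtlas (𝓡 n) ∞ Q)
    {x₀ : Euc n} (hx₀ : x₀ ∈ e.target) :
    ContMDiffAt (𝓡 n) 𝓘(ℝ, Euc n →L[ℝ] Euc n) ∞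
      (fun x => (tangentCoord (e.symm x₀) (e.symm x)).comp (symmDeriv e x)) x₀ := by
  have h := ((contMDiffOn_symm_of_mem_maximalAtlas he).contMDiffAt
    (e.open_target.mem_nhds hx₀)).mfderiv_const (m := ∞) (by simp)
  refine h.congr_of_eventuallyEq (.of_forall fun x => ?_)
  ext1 w
  simp only [inTangentCoordinates, ContinuousLinearMap.inCoordinates,
    TangentBundle.symmL_model_space, id]
  rfl

theorem contMDiffAt_chartDeriv_comp_tangentCoordSymm
    (he : e ∈ IsManifold.maximalAtlas (𝓡 n) ∞ Q) {q₀ : Q} (hq₀ : q₀ ∈ e.source) :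
    ContMDiffAt (𝓡 n) 𝓘(ℝ, Euc n →L[ℝ] Euc n) ∞
      (fun q => (chartDeriv e q).comp (tangentCoordSymm q₀ q)) q₀ := by
  have h := ((contMDiffOn_of_mem_maximalAtlas he).contMDiffAt
    (e.open_source.mem_nhds hq₀)).mfderiv_const (m := ∞) (by simp)
  refine h.congr_of_eventuallyEq (.of_forall fun x => ?_)
  ext1 w
  simp only [inTangentCoordinates, ContinuousLinearMap.inCoordinates,
    TangentBundle.continuousLinearMapAt_model_space, id]
  rfl

theorem contMDiffAt_velPoint (he : e ∈ IsManifold.maximalAtlas (𝓡 n) ∞ Q)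
    {y₀ : Euc n × (Euc k →L[ℝ] Euc n)} (hy₀ : y₀.1 ∈ e.target) :
    ContMDiffAt 𝓘(ℝ, Euc n × (Euc k →L[ℝ] Euc n)) (velModel n k) ∞
      (fun y => (velPoint e y.1 y.2 : Vel n k Q)) y₀ := by
  have h1 : ContMDiffAt 𝓘(ℝ, Euc n × (Euc k →L[ℝ] Euc n)) (𝓡 n) ∞
      (fun y : Euc n × (Euc k →L[ℝ] Euc n) => y.1) y₀ := contDiffAt_fst.contMDiffAt
  have h2 : ContMDiffAt 𝓘(ℝ, Euc n × (Euc k →L[ℝ] Euc n)) 𝓘(ℝ, Euc k →L[ℝ] Euc n) ∞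
      (fun y : Euc n × (Euc k →L[ℝ] Euc n) => y.2) y₀ := contDiffAt_snd.contMDiffAt
  rw [contMDiffAt_hom_bundle]
  refine ⟨contMDiffAt_chart_symm_fst he hy₀, ?_⟩
  have h := ContMDiffAt.clm_comp ((contMDiffAt_tangentCoord_comp_symmDeriv he hy₀).comp y₀ h1) h2
  refine h.congr_of_eventuallyEq (.of_forall fun y => ?_)
  exact inCoordinates_velFiber _ _ _

theorem contMDiffAt_covPoint (he : e ∈ IsManifold.maximalAtlas (𝓡 n) ∞ Q)
    {y₀ : Euc n × (Euc n →L[ℝ] Euc k)} (hy₀ : y₀.1 ∈ e.target) :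
    ContMDiffAt 𝓘(ℝ, Euc n × (Euc n →L[ℝ] Euc k)) (covModel n k) ∞
      (fun y => (covPoint e y.1 y.2 : Cov n k Q)) y₀ := by
  have h2 : ContMDiffAt 𝓘(ℝ, Euc n × (Euc n →L[ℝ] Euc k)) 𝓘(ℝ, Euc n →L[ℝ] Euc k) ∞
      (fun y : Euc n × (Euc n →L[ℝ] Euc k) => y.2) y₀ := contDiffAt_snd.contMDiffAt
  rw [contMDiffAt_hom_bundle]
  refine ⟨contMDiffAt_chart_symm_fst he hy₀, ?_⟩
  have h := ContMDiffAt.clm_comp h2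
    ((contMDiffAt_chartDeriv_comp_tangentCoordSymm he (e.map_target hy₀)).comp y₀
      (contMDiffAt_chart_symm_fst he hy₀))
  refine h.congr_of_eventuallyEq (.of_forall fun y => ?_)
  exact inCoordinates_covFiber _ _ _

theorem contMDiffAt_coordQ (he : e ∈ IsManifold.maximalAtlas (𝓡 n) ∞ Q)
    {α₀ : Cov n k Q} (hα₀ : α₀.1 ∈ e.source) :
    ContMDiffAt (covModel n k) (𝓡 n) ∞ (coordQ e) α₀ :=
  ((contMDiffOn_of_mem_maximalAtlas he).contMDiffAt (e.open_source.mem_nhds hα₀)).comp α₀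
    (contMDiffAt_proj _)

theorem contMDiffAt_coordP (he : e ∈ IsManifold.maximalAtlas (𝓡 n) ∞ Q)
    {α₀ : Cov n k Q} (hα₀ : α₀.1 ∈ e.source) :
    ContMDiffAt (covModel n k) 𝓘(ℝ, Euc n →L[ℝ] Euc k) ∞ (coordP e) α₀ := by
  obtain ⟨h1, h2⟩ := (contMDiffAt_hom_bundle (n := ∞) (IB := 𝓡 n) (id : Cov n k Q → Cov n k Q)).1
    (contMDiffAt_id (x := α₀))
  have h := ContMDiffAt.clm_comp h2
    ((contMDiffAt_tangentCoord_comp_symmDeriv he (e.map_source hα₀)).comp α₀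
      (contMDiffAt_coordQ he hα₀))
  have hopen : ∀ᶠ α : Cov n k Q in 𝓝 α₀,
      α.1 ∈ e.source ∩ (trivializationAt (Euc n) (TangentSpace (𝓡 n)) α₀.1).baseSet :=
    h1.continuousAt.eventually_mem (IsOpen.mem_nhds
      (e.open_source.inter (Trivialization.open_baseSet _))
      ⟨hα₀, mem_baseSet_trivializationAt _ _ _⟩)
  refine h.congr_of_eventuallyEq (hopen.mono fun α hα => ?_)
  dsimp only [id, Function.comp_apply, coordQ]
  -- The trivialization and its inverse meet in the middle and cancel, leaving `α` composed with the
  -- derivative of the inverse chart.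
  rw [inCoordinates_covFiber, e.left_inv hα₀, e.left_inv hα.1, ContinuousLinearMap.comp_assoc,
    ← ContinuousLinearMap.comp_assoc _ _ (symmDeriv e _), tangentCoordSymm_comp_tangentCoord hα.2,
    ContinuousLinearMap.id_comp]
  rfl

end Coord

/-! ### Induced coordinate systems as charts of the bundles. -/

section CoordMaps

variable {n k : ℕ} {Q : Type*} [TopologicalSpace Q] [ChartedSpace (Euc n) Q]
  {e : OpenPartialHomeomorph Q (Euc n)}

theorem mk_velFiber_congr {q q' : Q} (h : q = q') (v : Euc k →L[ℝ] Euc n) :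
    (⟨q, v⟩ : Vel n k Q) = ⟨q', v⟩ := by subst h; rfl

theorem mk_covFiber_congr {q q' : Q} (h : q = q') (α : Euc n →L[ℝ] Euc k) :
    (⟨q, α⟩ : Cov n k Q) = ⟨q', α⟩ := by subst h; rfl

/-- The coordinates `(q^i, v^i_A)` of a point of `T¹ₖQ`. -/
noncomputable def velCoord (e : OpenPartialHomeomorph Q (Euc n)) (v : Vel n k Q) :
    Euc n × (Euc k →L[ℝ] Euc n) :=
  (e v.1, (chartDeriv e v.1).comp (show Euc k →L[ℝ] Euc n from v.2))

/-- The coordinates `(q^i, p^A_i)` of a point of `(T¹ₖ)*Q`. -/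
noncomputable def covCoord (e : OpenPartialHomeomorph Q (Euc n)) (α : Cov n k Q) :
    Euc n × (Euc n →L[ℝ] Euc k) :=
  (coordQ e α, coordP e α)

theorem velCoord_velPoint (he : e ∈ IsManifold.maximalAtlas (𝓡 n) ∞ Q) {x : Euc n}
    (hx : x ∈ e.target) (V : Euc k →L[ℝ] Euc n) :
    velCoord e (velPoint e x V : Vel n k Q) = (x, V) := by
  refine Prod.ext (e.right_inv hx) ?_
  change (chartDeriv e (e.symm x)).comp ((symmDeriv e x).comp V) = V
  rw [← ContinuousLinearMap.comp_assoc, chartDeriv_comp_symmDeriv he hx,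
    ContinuousLinearMap.id_comp]

theorem velPoint_velCoord (he : e ∈ IsManifold.maximalAtlas (𝓡 n) ∞ Q) {v : Vel n k Q}
    (hv : v.1 ∈ e.source) : velPoint e (velCoord e v).1 (velCoord e v).2 = v := by
  obtain ⟨q, v⟩ := v
  have h : (symmDeriv e (e q)).comp ((chartDeriv e q).comp (show Euc k →L[ℝ] Euc n from v)) = v := by
    rw [← ContinuousLinearMap.comp_assoc, symmDeriv_comp_chartDeriv he hv,
      ContinuousLinearMap.id_comp]
  refine (mk_velFiber_congr (e.left_inv hv) _).trans ?_
  exact congrArg (TotalSpace.mk q) h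

theorem covCoord_covPoint (he : e ∈ IsManifold.maximalAtlas (𝓡 n) ∞ Q) {x : Euc n}
    (hx : x ∈ e.target) (P : Euc n →L[ℝ] Euc k) :
    covCoord e (covPoint e x P : Cov n k Q) = (x, P) := by
  refine Prod.ext (e.right_inv hx) ?_
  change (P.comp (chartDeriv e (e.symm x))).comp (symmDeriv e (e (e.symm x))) = P
  rw [e.right_inv hx, ContinuousLinearMap.comp_assoc, chartDeriv_comp_symmDeriv he hx,
    ContinuousLinearMap.comp_id]

theorem covPoint_covCoord (he : e ∈ IsManifold.maximalAtlas (𝓡 n) ∞ Q) {α : Cov n k Q}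
    (hα : α.1 ∈ e.source) : covPoint e (covCoord e α).1 (covCoord e α).2 = α := by
  obtain ⟨q, α⟩ := α
  have h : ((show Euc n →L[ℝ] Euc k from α).comp (symmDeriv e (e q))).comp (chartDeriv e q) = α := by
    rw [ContinuousLinearMap.comp_assoc, symmDeriv_comp_chartDeriv he hα,
      ContinuousLinearMap.comp_id]
  -- The intermediate point separates two uses of `e.symm (e q) = q`: inside the chart derivative,
  -- then in the base point.
  refine Eq.trans (b := ⟨e.symm (e q),
    ((show Euc n →L[ℝ] Euc k from α).comp (symmDeriv e (e q))).comp (chartDeriv e q)⟩) ?_ ?_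
  · change (⟨e.symm (e q), ((show Euc n →L[ℝ] Euc k from α).comp (symmDeriv e (e q))).comp
      (chartDeriv e (e.symm (e q)))⟩ : Cov n k Q) = _
    rw [show chartDeriv e (e.symm (e q)) = chartDeriv e q from congrArg _ (e.left_inv hα)]
  · exact (mk_covFiber_congr (e.left_inv hα) _).trans (congrArg (TotalSpace.mk q) h)

/-- The point of the Whitney sum with given coordinates. -/
noncomputable def whitneyPoint (e : OpenPartialHomeomorph Q (Euc n))
    (y : Euc n × ((Euc k →L[ℝ] Euc n) × (Euc n →L[ℝ] Euc k))) : Whitney n k Q :=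
  ⟨e.symm y.1, ((velPoint e y.1 y.2.1 : Vel n k Q).2, (covPoint e y.1 y.2.2 : Cov n k Q).2)⟩

theorem exists_whitneyPoint_eq (he : e ∈ IsManifold.maximalAtlas (𝓡 n) ∞ Q)
    {z : Whitney n k Q} (hz : z.1 ∈ e.source) :
    ∃ y, y.1 ∈ e.target ∧ whitneyPoint e y = z := by
  refine ⟨(e z.1, (velCoord e (pr₁ z)).2, (covCoord e (pr₂ z)).2), e.map_source hz, ?_⟩
  have h1 := velPoint_velCoord (v := pr₁ z) he hz
  have h2 := covPoint_covCoord (α := pr₂ z) he hz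
  obtain ⟨q, v, α⟩ := z
  -- With base point and fibre components generalized, the equality of base points can be
  -- substituted away before the fibres are compared.
  have key : ∀ (q' : Q) (v' : VelFiber n k Q q') (α' : CovFiber n k Q q'),
      (⟨q', v'⟩ : Vel n k Q) = ⟨q, v⟩ → (⟨q', α'⟩ : Cov n k Q) = ⟨q, α⟩ →
        (⟨q', (v', α')⟩ : Whitney n k Q) = ⟨q, (v, α)⟩ := by
    rintro q' v' α' h h'
    obtain rfl : q' = q := congrArg TotalSpace.proj h
    rw [TotalSpace.mk_inj] at h h'
    rw [h, h']
  exact key _ _ _ h1 h2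

variable [IsManifold (𝓡 n) ∞ Q]

theorem contMDiffAt_covCoord (he : e ∈ IsManifold.maximalAtlas (𝓡 n) ∞ Q)
    {α₀ : Cov n k Q} (hα₀ : α₀.1 ∈ e.source) :
    ContMDiffAt (covModel n k) 𝓘(ℝ, Euc n × (Euc n →L[ℝ] Euc k)) ∞ (covCoord e) α₀ :=
  (contMDiffAt_coordQ he hα₀).prodMk_space (contMDiffAt_coordP he hα₀)

theorem contMDiffAt_velCoord (he : e ∈ IsManifold.maximalAtlas (𝓡 n) ∞ Q)
    {v₀ : Vel n k Q} (hv₀ : v₀.1 ∈ e.source) :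
    ContMDiffAt (velModel n k) 𝓘(ℝ, Euc n × (Euc k →L[ℝ] Euc n)) ∞ (velCoord e) v₀ := by
  obtain ⟨h1, h2⟩ := (contMDiffAt_hom_bundle (n := ∞) (IB := 𝓡 n) (id : Vel n k Q → Vel n k Q)).1
    (contMDiffAt_id (x := v₀))
  have h3 := ((contMDiffOn_of_mem_maximalAtlas he).contMDiffAt
    (e.open_source.mem_nhds hv₀)).comp v₀ h1
  have h := ContMDiffAt.clm_comp
    ((contMDiffAt_chartDeriv_comp_tangentCoordSymm he hv₀).comp v₀ h1) h2
  have hopen : ∀ᶠ v : Vel n k Q in 𝓝 v₀,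
      v.1 ∈ (trivializationAt (Euc n) (TangentSpace (𝓡 n)) v₀.1).baseSet :=
    h1.continuousAt.eventually_mem (IsOpen.mem_nhds (Trivialization.open_baseSet _)
      (mem_baseSet_trivializationAt _ _ _))
  refine h3.prodMk_space (h.congr_of_eventuallyEq (hopen.mono fun v hv => ?_))
  dsimp only [id, Function.comp_apply]
  rw [inCoordinates_velFiber, ContinuousLinearMap.comp_assoc,
    ← ContinuousLinearMap.comp_assoc (tangentCoordSymm _ _),
    tangentCoordSymm_comp_tangentCoord hv, ContinuousLinearMap.id_comp]

/-- The induced chart of `T¹ₖQ`. -/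
noncomputable def velChart (he : e ∈ IsManifold.maximalAtlas (𝓡 n) ∞ Q) :
    OpenPartialHomeomorph (Vel n k Q) (Euc n × (Euc k →L[ℝ] Euc n)) where
  toFun := velCoord e
  invFun y := velPoint e y.1 y.2
  source := TotalSpace.proj ⁻¹' e.source
  target := e.target ×ˢ Set.univ
  map_source' _ hv := ⟨e.map_source hv, Set.mem_univ _⟩
  map_target' _ hy := e.map_target hy.1
  left_inv' _ hv := velPoint_velCoord he hv
  right_inv' _ hy := velCoord_velPoint he hy.1 _
  open_source := e.open_source.preimage (FiberBundle.continuous_proj _ _)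
  open_target := e.open_target.prod isOpen_univ
  continuousOn_toFun _ hv := (contMDiffAt_velCoord he hv).continuousAt.continuousWithinAt
  continuousOn_invFun _ hy := (contMDiffAt_velPoint he hy.1).continuousAt.continuousWithinAt

/-- The induced chart of `(T¹ₖ)*Q`. -/
noncomputable def covChart (he : e ∈ IsManifold.maximalAtlas (𝓡 n) ∞ Q) :
    OpenPartialHomeomorph (Cov n k Q) (Euc n × (Euc n →L[ℝ] Euc k)) where
  toFun := covCoord e
  invFun y := covPoint e y.1 y.2
  source := TotalSpace.proj ⁻¹' e.source
  target := e.target ×ˢ Set.univ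
  map_source' _ hv := ⟨e.map_source hv, Set.mem_univ _⟩
  map_target' _ hy := e.map_target hy.1
  left_inv' _ hv := covPoint_covCoord he hv
  right_inv' _ hy := covCoord_covPoint he hy.1 _
  open_source := e.open_source.preimage (FiberBundle.continuous_proj _ _)
  open_target := e.open_target.prod isOpen_univ
  continuousOn_toFun _ hv := (contMDiffAt_covCoord he hv).continuousAt.continuousWithinAt
  continuousOn_invFun _ hy := (contMDiffAt_covPoint he hy.1).continuousAt.continuousWithinAt

/-! ### The Whitney sum -/

theorem contMDiff_pr₁ : ContMDiff (whitneyModel n k) (velModel n k) ∞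
    (pr₁ (n := n) (k := k) (Q := Q)) := by
  intro z
  obtain ⟨h1, h2⟩ := (contMDiffAt_totalSpace (n := ∞) (IB := 𝓡 n)
    (f := (id : Whitney n k Q → Whitney n k Q))).1 (contMDiffAt_id (x := z))
  have h3 := (contDiff_fst (𝕜 := ℝ) (n := ∞) (E := Euc k →L[ℝ] Euc n)
    (F := Euc n →L[ℝ] Euc k)).contMDiff.contMDiffAt.comp z h2
  exact contMDiffAt_totalSpace.2 ⟨h1, h3⟩

theorem contMDiff_pr₂ : ContMDiff (whitneyModel n k) (covModel n k) ∞
    (pr₂ (n := n) (k := k) (Q := Q)) := by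
  intro z
  obtain ⟨h1, h2⟩ := (contMDiffAt_totalSpace (n := ∞) (IB := 𝓡 n)
    (f := (id : Whitney n k Q → Whitney n k Q))).1 (contMDiffAt_id (x := z))
  have h3 := (contDiff_snd (𝕜 := ℝ) (n := ∞) (E := Euc k →L[ℝ] Euc n)
    (F := Euc n →L[ℝ] Euc k)).contMDiff.contMDiffAt.comp z h2
  exact contMDiffAt_totalSpace.2 ⟨h1, h3⟩

theorem contMDiffAt_whitneyPoint (he : e ∈ IsManifold.maximalAtlas (𝓡 n) ∞ Q)
    {y₀ : Euc n × ((Euc k →L[ℝ] Euc n) × (Euc n →L[ℝ] Euc k))} (hy₀ : y₀.1 ∈ e.target) :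
    ContMDiffAt 𝓘(ℝ, Euc n × ((Euc k →L[ℝ] Euc n) × (Euc n →L[ℝ] Euc k))) (whitneyModel n k) ∞
      (whitneyPoint e : _ → Whitney n k Q) y₀ := by
  have h1 : ContMDiffAt 𝓘(ℝ, Euc n × ((Euc k →L[ℝ] Euc n) × (Euc n →L[ℝ] Euc k)))
      𝓘(ℝ, Euc n × (Euc k →L[ℝ] Euc n)) ∞
      (fun y : Euc n × ((Euc k →L[ℝ] Euc n) × (Euc n →L[ℝ] Euc k)) => (y.1, y.2.1)) y₀ :=
    (contDiffAt_fst.prodMk (contDiffAt_fst.comp y₀ contDiffAt_snd)).contMDiffAt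
  have h2 : ContMDiffAt 𝓘(ℝ, Euc n × ((Euc k →L[ℝ] Euc n) × (Euc n →L[ℝ] Euc k)))
      𝓘(ℝ, Euc n × (Euc n →L[ℝ] Euc k)) ∞
      (fun y : Euc n × ((Euc k →L[ℝ] Euc n) × (Euc n →L[ℝ] Euc k)) => (y.1, y.2.2)) y₀ :=
    (contDiffAt_fst.prodMk (contDiffAt_snd.comp y₀ contDiffAt_snd)).contMDiffAt
  obtain ⟨h3, h4⟩ := contMDiffAt_totalSpace.1
    (ContMDiffAt.comp y₀ (contMDiffAt_velPoint (k := k) (y₀ := (y₀.1, y₀.2.1)) he hy₀) h1)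
  obtain ⟨-, h5⟩ := contMDiffAt_totalSpace.1
    (ContMDiffAt.comp y₀ (contMDiffAt_covPoint (k := k) (y₀ := (y₀.1, y₀.2.2)) he hy₀) h2)
  exact contMDiffAt_totalSpace.2 ⟨h3, h4.prodMk_space h5⟩

end CoordMaps

/-! ### Exterior derivative of `p dq` -/

section ExtDeriv

variable {E : Type*} [NormedAddCommGroup E] [NormedSpace ℝ E] {H : Type*} [TopologicalSpace H]
  {I : ModelWithCorners ℝ E H} [I.Boundaryless] {M : Type*} [TopologicalSpace M] [ChartedSpace H M]
  [IsManifold I ∞ M] {X : Type*} [NormedAddCommGroup X] [NormedSpace ℝ X]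

/-- The derivative of a vector-valued function in the direction of a tangent vector. -/
noncomputable def dirDeriv (I : ModelWithCorners ℝ E H) (f : M → X) (x : M) (u : TangentSpace I x) :
    X :=
  mfderiv I 𝓘(ℝ, X) f x u

/-- `extDerivOneForm` is defined through the preferred chart; this removes that chart from the
result of a computation done there. -/
theorem fderiv_comp_extChartAt_symm {f : M → X} {x₀ : M} (hf : MDifferentiableAt I 𝓘(ℝ, X) f x₀)
    (u : TangentSpace I x₀) :
    fderiv ℝ (f ∘ (extChartAt I x₀).symm) (extChartAt I x₀ x₀)
      (mfderiv I 𝓘(ℝ, E) (extChartAt I x₀) x₀ u) = dirDeriv I f x₀ u := by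
  have h : f =ᶠ[𝓝 x₀] (f ∘ (extChartAt I x₀).symm) ∘ extChartAt I x₀ := by
    filter_upwards [extChartAt_source_mem_nhds (I := I) x₀] with x hx
    exact (congrArg f ((extChartAt I x₀).left_inv hx)).symm
  have hs : MDifferentiableAt 𝓘(ℝ, E) I (extChartAt I x₀).symm (extChartAt I x₀ x₀) := by
    have := mdifferentiableWithinAt_extChartAt_symm (I := I) (mem_extChartAt_target (I := I) x₀)
    rwa [I.range_eq_univ, mdifferentiableWithinAt_univ] at this
  have hf' : MDifferentiableAt I 𝓘(ℝ, X) f ((extChartAt I x₀).symm (extChartAt I x₀ x₀)) := by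
    rwa [extChartAt_to_inv]
  rw [dirDeriv, h.mfderiv_eq, mfderiv_comp x₀ (hf'.comp _ hs)
    (mdifferentiableAt_extChartAt (mem_chart_source H x₀)), mfderiv_eq_fderiv]
  rfl

theorem contDiffAt_comp_extChartAt_symm {f : M → X} {x₀ : M}
    (hf : ContMDiffAt I 𝓘(ℝ, X) ∞ f x₀) :
    ContDiffAt ℝ ∞ (f ∘ (extChartAt I x₀).symm) (extChartAt I x₀ x₀) := by
  have hs := contMDiffWithinAt_extChartAt_symm_range (I := I) (n := ∞) x₀
    (mem_extChartAt_target (I := I) x₀)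
  rw [I.range_eq_univ, contMDiffWithinAt_univ] at hs
  have hf' : ContMDiffAt I 𝓘(ℝ, X) ∞ f ((extChartAt I x₀).symm (extChartAt I x₀ x₀)) := by
    rwa [extChartAt_to_inv]
  exact (hf'.comp _ hs).contDiffAt

/-- `d(p dq) = dp ∧ dq`. -/
theorem extDerivOneForm_eq {θ : (x : M) → TangentSpace I x →L[ℝ] ℝ} {p : M → X →L[ℝ] ℝ} {q : M → X}
    {x₀ : M} (hp : ContMDiffAt I 𝓘(ℝ, X →L[ℝ] ℝ) ∞ p x₀) (hq : ContMDiffAt I 𝓘(ℝ, X) ∞ q x₀)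
    (hθ : ∀ᶠ x in 𝓝 x₀, ∀ u, θ x u = p x (dirDeriv I q x u)) (u w : TangentSpace I x₀) :
    extDerivOneForm I θ x₀ u w =
      dirDeriv I p x₀ u (dirDeriv I q x₀ w) - dirDeriv I p x₀ w (dirDeriv I q x₀ u) := by
  rw [← fderiv_comp_extChartAt_symm (hp.mdifferentiableAt (by simp)),
    ← fderiv_comp_extChartAt_symm (hp.mdifferentiableAt (by simp)),
    ← fderiv_comp_extChartAt_symm (hq.mdifferentiableAt (by simp)),
    ← fderiv_comp_extChartAt_symm (hq.mdifferentiableAt (by simp))]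
  simp only [extDerivOneForm, I.range_eq_univ, fderivWithin_univ]
  have hp' := contDiffAt_comp_extChartAt_symm hp
  have hq' := contDiffAt_comp_extChartAt_symm hq
  set y₀ := extChartAt I x₀ x₀ with hy₀
  set f := p ∘ (extChartAt I x₀).symm with hf
  set g := q ∘ (extChartAt I x₀).symm with hg
  suffices h : ∀ u' w' : E, fderiv ℝ (localOneForm I θ x₀) y₀ u' w' -
      fderiv ℝ (localOneForm I θ x₀) y₀ w' u' =
        fderiv ℝ f y₀ u' (fderiv ℝ g y₀ w') - fderiv ℝ f y₀ w' (fderiv ℝ g y₀ u') from h _ _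
  intro u' w'
  -- In the preferred chart `θ` becomes `y ↦ f(y) ∘ Dg(y)`, whose derivative contains `D²g`.
  have hloc : localOneForm I θ x₀ =ᶠ[𝓝 y₀] fun y => (f y).comp (fderiv ℝ g y) := by
    have hq1 : ∀ᶠ x in 𝓝 x₀, MDifferentiableAt I 𝓘(ℝ, X) q x := by
      filter_upwards [contMDiffAt_iff_contMDiffAt_nhds (n := 1) (by simp) |>.1 (hq.of_le (by simp))] with x hx
      exact hx.mdifferentiableAt (by simp)
    have hc : Filter.Tendsto (extChartAt I x₀).symm (𝓝 y₀) (𝓝 x₀) := by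
      have := continuousAt_extChartAt_symm (I := I) x₀
      rwa [ContinuousAt, extChartAt_to_inv] at this
    filter_upwards [hc.eventually hθ, hc.eventually hq1,
      extChartAt_target_mem_nhds (I := I) x₀] with y h1 h2 h3
    have hs : MDifferentiableAt 𝓘(ℝ, E) I (extChartAt I x₀).symm y := by
      have := mdifferentiableWithinAt_extChartAt_symm (I := I) h3
      rwa [I.range_eq_univ, mdifferentiableWithinAt_univ] at this
    ext1 v
    have hgd : fderiv ℝ g y = (mfderiv I 𝓘(ℝ, X) q ((extChartAt I x₀).symm y)).comp
        (mfderiv 𝓘(ℝ, E) I (extChartAt I x₀).symm y) := by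
      rw [← mfderiv_eq_fderiv]; exact mfderiv_comp y h2 hs
    rw [hgd]
    simp only [localOneForm, I.range_eq_univ, mfderivWithin_univ]
    exact h1 _
  rw [hloc.fderiv_eq]
  have hD : HasFDerivAt (fderiv ℝ g) (fderiv ℝ (fderiv ℝ g) y₀) y₀ :=
    ((hq'.fderiv_right (m := ∞) (by simp)).differentiableAt (by simp)).hasFDerivAt
  have hP : HasFDerivAt f (fderiv ℝ f y₀) y₀ := (hp'.differentiableAt (by simp)).hasFDerivAt
  rw [(hP.clm_comp hD).fderiv]
  -- Symmetry of `D²g` is the identity `d(dq) = 0`: the two terms `p · D²q` cancel after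
  -- antisymmetrization.
  have hsymm := (hq'.isSymmSndFDerivAt (by
    rw [minSmoothness_of_isRCLikeNormedField]; exact WithTop.coe_le_coe.2 (le_top : (2 : ℕ∞) ≤ ⊤))).eq u' w'
  change (f y₀ (fderiv ℝ (fderiv ℝ g) y₀ u' w') + fderiv ℝ f y₀ u' (fderiv ℝ g y₀ w')) -
    (f y₀ (fderiv ℝ (fderiv ℝ g) y₀ w' u') + fderiv ℝ f y₀ w' (fderiv ℝ g y₀ u')) = _
  rw [hsymm]
  ring

end ExtDeriv

/-! ### Chain rules for directional derivatives. -/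

section DirDeriv

variable {E : Type*} [NormedAddCommGroup E] [NormedSpace ℝ E] {H : Type*} [TopologicalSpace H]
  {I : ModelWithCorners ℝ E H} {M : Type*} [TopologicalSpace M] [ChartedSpace H M]
  {E' : Type*} [NormedAddCommGroup E'] [NormedSpace ℝ E'] {H' : Type*} [TopologicalSpace H']
  {I' : ModelWithCorners ℝ E' H'} {M' : Type*} [TopologicalSpace M'] [ChartedSpace H' M']
  {X Y : Type*} [NormedAddCommGroup X] [NormedSpace ℝ X] [NormedAddCommGroup Y] [NormedSpace ℝ Y]

theorem dirDeriv_clm_comp (T : X →L[ℝ] Y) {f : M → X} {x : M}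
    (hf : MDifferentiableAt I 𝓘(ℝ, X) f x) (u : TangentSpace I x) :
    dirDeriv I (fun x => T (f x)) x u = T (dirDeriv I f x u) := by
  have h := mfderiv_comp x (T.mdifferentiableAt (x := f x)) hf
  rw [ContinuousLinearMap.mfderiv_eq] at h
  exact congrArg (fun D => D u) h

theorem dirDeriv_mfderiv {f : M → X} {φ : M' → M} {x : M'}
    (hf : MDifferentiableAt I 𝓘(ℝ, X) f (φ x)) (hφ : MDifferentiableAt I' I φ x)
    (u : TangentSpace I' x) :
    dirDeriv I f (φ x) (mfderiv I' I φ x u) = dirDeriv I' (fun x => f (φ x)) x u :=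
  (congrArg (fun D => D u) (mfderiv_comp x hf hφ)).symm

theorem dirDeriv_mfderiv_eq_fderiv {f : M → X} {κ : E' → M} {y : E'}
    (hf : MDifferentiableAt I 𝓘(ℝ, X) f (κ y)) (hκ : MDifferentiableAt 𝓘(ℝ, E') I κ y) (u : E') :
    dirDeriv I f (κ y) (mfderiv 𝓘(ℝ, E') I κ y u) = fderiv ℝ (fun y => f (κ y)) y u :=
  (dirDeriv_mfderiv hf hκ u).trans (congrArg (fun D : E' →L[ℝ] X => D u)
    (mfderiv_eq_fderiv (f := fun y => f (κ y))))

end DirDeriv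

/-! ### The unified field equation in coordinates. -/

section Unified

variable {n k : ℕ} {Q : Type*} [TopologicalSpace Q] [ChartedSpace (Euc n) Q]
  {e : OpenPartialHomeomorph Q (Euc n)}

/-- The coordinate expression of a Lagrangian. -/
noncomputable def localLagrangian (L : Vel n k Q → ℝ) (e : OpenPartialHomeomorph Q (Euc n))
    (y : Euc n × (Euc k →L[ℝ] Euc n)) : ℝ :=
  L (velPoint e y.1 y.2)

/-- Velocities transform by the derivative of the inverse chart and momenta by that of the chart, so
the coupling keeps the form `p·v`. -/
theorem unifiedHamiltonian_whitneyPoint (he : e ∈ IsManifold.maximalAtlas (𝓡 n) ∞ Q)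
    (L : Vel n k Q → ℝ) {y : Euc n × ((Euc k →L[ℝ] Euc n) × (Euc n →L[ℝ] Euc k))}
    (hy : y.1 ∈ e.target) :
    unifiedHamiltonian L (whitneyPoint e y) =
      pairing n k y.2.2 y.2.1 - localLagrangian L e (y.1, y.2.1) := by
  have h : coupling (whitneyPoint e y : Whitney n k Q) = pairing n k
      (y.2.2.comp ((chartDeriv e (e.symm y.1)).comp (symmDeriv e y.1))) y.2.1 := by
    rw [pairing_apply]; rfl
  rw [chartDeriv_comp_symmDeriv he hy, ContinuousLinearMap.comp_id] at h
  rw [unifiedHamiltonian, h]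
  rfl

variable [IsManifold (𝓡 n) ∞ Q]

theorem liouvilleForm_eq (he : e ∈ IsManifold.maximalAtlas (𝓡 n) ∞ Q) (A : Fin k) {α : Cov n k Q}
    (hα : α.1 ∈ e.source) (u : TangentSpace (covModel n k) α) :
    liouvilleForm A α u =
      (EuclideanSpace.proj A : Euc k →L[ℝ] ℝ).comp (coordP e α)
        (dirDeriv (covModel n k) (coordQ e) α u) := by
  have h1 : MDifferentiableAt (𝓡 n) (𝓡 n) e α.1 :=
    ((contMDiffOn_of_mem_maximalAtlas he).contMDiffAt
      (e.open_source.mem_nhds hα)).mdifferentiableAt (by simp)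
  have h2 : MDifferentiableAt (covModel n k) (𝓡 n) (TotalSpace.proj : Cov n k Q → Q) α :=
    (contMDiffAt_proj (n := ∞) (CovFiber n k Q)).mdifferentiableAt (by simp)
  have h3 : dirDeriv (covModel n k) (coordQ e) α u =
      chartDeriv e α.1 (mfderiv (covModel n k) (𝓡 n) (TotalSpace.proj : Cov n k Q → Q) α u) :=
    congrArg (fun D => D u) (mfderiv_comp α h1 h2)
  have h4 := symmDeriv_comp_chartDeriv he hα
  rw [h3]
  change _ = ((show Euc n →L[ℝ] Euc k from α.2) ((symmDeriv e (e α.1)).comp (chartDeriv e α.1)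
    (mfderiv (covModel n k) (𝓡 n) (TotalSpace.proj : Cov n k Q → Q) α u))) A
  rw [h4]
  rfl

/-- By `liouvilleForm_eq`, `(θ₀)_A` is `p^A_i dq^i` near `α`, so `extDerivOneForm_eq` applies; the
sign in `-dθ` yields `dq ∧ dp`. -/
theorem canonicalForm_eq (he : e ∈ IsManifold.maximalAtlas (𝓡 n) ∞ Q) (A : Fin k) {α : Cov n k Q}
    (hα : α.1 ∈ e.source) (u w : TangentSpace (covModel n k) α) :
    canonicalForm A α u w =
      dirDeriv (covModel n k) (coordP e) α w (dirDeriv (covModel n k) (coordQ e) α u) A -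
      dirDeriv (covModel n k) (coordP e) α u (dirDeriv (covModel n k) (coordQ e) α w) A := by
  have hp := contMDiffAt_coordP (k := k) he hα
  have hq := contMDiffAt_coordQ (k := k) he hα
  let T : (Euc n →L[ℝ] Euc k) →L[ℝ] (Euc n →L[ℝ] ℝ) :=
    ContinuousLinearMap.compL ℝ (Euc n) (Euc k) ℝ (EuclideanSpace.proj A)
  have hTp : ContMDiffAt (covModel n k) 𝓘(ℝ, Euc n →L[ℝ] ℝ) ∞ (fun α => T (coordP e α)) α :=
    T.contMDiff.contMDiffAt.comp α hp
  have hev : ∀ᶠ β : Cov n k Q in 𝓝 α, β.1 ∈ e.source :=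
    (FiberBundle.continuous_proj (Euc n →L[ℝ] Euc k) (CovFiber n k Q)).continuousAt.eventually_mem
      (e.open_source.mem_nhds hα)
  rw [canonicalForm, extDerivOneForm_eq hTp hq (hev.mono fun β hβ v => liouvilleForm_eq he A hβ v),
    dirDeriv_clm_comp T (hp.mdifferentiableAt (by simp)),
    dirDeriv_clm_comp T (hp.mdifferentiableAt (by simp)), neg_sub]
  rfl

theorem unifiedForm_eq (he : e ∈ IsManifold.maximalAtlas (𝓡 n) ∞ Q) (A : Fin k)
    {z : Whitney n k Q} (hz : z.1 ∈ e.source) (u w : TangentSpace (whitneyModel n k) z) :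
    unifiedForm A z u w =
      dirDeriv (whitneyModel n k) (fun z => coordP e (pr₂ z)) z w
        (dirDeriv (whitneyModel n k) (fun z => coordQ e (pr₂ z)) z u) A -
      dirDeriv (whitneyModel n k) (fun z => coordP e (pr₂ z)) z u
        (dirDeriv (whitneyModel n k) (fun z => coordQ e (pr₂ z)) z w) A := by
  have h := (contMDiff_pr₂ (n := n) (k := k) (Q := Q) z).mdifferentiableAt (by simp)
  have hp := (contMDiffAt_coordP (k := k) (α₀ := pr₂ z) he hz).mdifferentiableAt (by simp)
  have hq := (contMDiffAt_coordQ (k := k) (α₀ := pr₂ z) he hz).mdifferentiableAt (by simp)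
  rw [unifiedForm, canonicalForm_eq he A (α := pr₂ z) hz, dirDeriv_mfderiv hp h,
    dirDeriv_mfderiv hp h, dirDeriv_mfderiv hq h, dirDeriv_mfderiv hq h]

theorem contDiffAt_localLagrangian (he : e ∈ IsManifold.maximalAtlas (𝓡 n) ∞ Q)
    {L : Vel n k Q → ℝ} (hL : ContMDiff (velModel n k) 𝓘(ℝ, ℝ) ∞ L)
    {y : Euc n × (Euc k →L[ℝ] Euc n)} (hy : y.1 ∈ e.target) :
    ContDiffAt ℝ ∞ (localLagrangian L e) y :=
  (ContMDiffAt.comp y (hL _) (contMDiffAt_velPoint he hy)).contDiffAt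

theorem fderiv_unifiedHamiltonian_whitneyPoint (he : e ∈ IsManifold.maximalAtlas (𝓡 n) ∞ Q)
    {L : Vel n k Q → ℝ} (hL : ContMDiff (velModel n k) 𝓘(ℝ, ℝ) ∞ L)
    {y : Euc n × ((Euc k →L[ℝ] Euc n) × (Euc n →L[ℝ] Euc k))} (hy : y.1 ∈ e.target)
    (ξ : Euc n) (R : Euc n →L[ℝ] Euc k) :
    fderiv ℝ (fun y => unifiedHamiltonian L (whitneyPoint e y)) y (ξ, 0, R) =
      pairing n k R y.2.1 - fderiv ℝ (localLagrangian L e) (y.1, y.2.1) (ξ, 0) := by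
  have hev : (fun y => unifiedHamiltonian L (whitneyPoint e y)) =ᶠ[𝓝 y] fun y =>
      pairing n k y.2.2 y.2.1 - localLagrangian L e (y.1, y.2.1) := by
    filter_upwards [continuousAt_fst.eventually_mem (e.open_target.mem_nhds hy)] with y' hy'
    exact unifiedHamiltonian_whitneyPoint he L hy'
  rw [hev.fderiv_eq]
  exact fderiv_pairing_sub (pairing n k)
    ((contDiffAt_localLagrangian he hL (y := (y.1, y.2.1)) hy).differentiableAt (by simp)) ξ R

-- Differentiability of `ℋ` on the Whitney sum is needed for the chain rule along `whitneyPoint`,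
-- which turns `dℋ` into a coordinate derivative.
set_option synthInstance.maxHeartbeats 200000 in
theorem contMDiffAt_unifiedHamiltonian (he : e ∈ IsManifold.maximalAtlas (𝓡 n) ∞ Q)
    {L : Vel n k Q → ℝ} (hL : ContMDiff (velModel n k) 𝓘(ℝ, ℝ) ∞ L) {z : Whitney n k Q}
    (hz : z.1 ∈ e.source) :
    ContMDiffAt (whitneyModel n k) 𝓘(ℝ, ℝ) ∞ (unifiedHamiltonian L) z := by
  have hp := (contMDiffAt_coordP (k := k) (α₀ := pr₂ z) he hz).comp z (contMDiff_pr₂ z)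
  have hv := (contMDiffAt_velCoord (k := k) (v₀ := pr₁ z) he hz).comp z (contMDiff_pr₁ z)
  have hv' := contDiff_snd.contMDiff.contMDiffAt.comp z hv
  have h := (ContMDiffAt.clm_apply ((pairing n k).contMDiff.contMDiffAt.comp z hp) hv').sub
    ((hL (pr₁ z)).comp z (contMDiff_pr₁ z))
  have hev : ∀ᶠ w : Whitney n k Q in 𝓝 z, w.1 ∈ e.source :=
    (contMDiffAt_proj (n := ∞) (IB := 𝓡 n) (VelFiber n k Q ×ᵇ CovFiber n k Q)
      (p := z)).continuousAt.eventually_mem (e.open_source.mem_nhds hz)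
  refine h.congr_of_eventuallyEq (hev.mono fun w hw => ?_)
  have h1 : pairing n k (coordP e (pr₂ w)) (velCoord e (pr₁ w)).2 =
      ∑ A : Fin k, (show Euc n →L[ℝ] Euc k from w.2.2)
        ((symmDeriv e (e w.1)).comp (chartDeriv e w.1) (w.2.1 (basisVec A))) A := by
    rw [pairing_apply]; rfl
  rw [symmDeriv_comp_chartDeriv he hw] at h1
  exact congrArg (fun r => r - L (pr₁ w)) h1.symm

/-- The equation `∑_A ι_{Z_A} Ω_A = dℋ` in coordinates. -/
theorem SolvesUnifiedAt.eq_coord (he : e ∈ IsManifold.maximalAtlas (𝓡 n) ∞ Q)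
    {L : Vel n k Q → ℝ} (hL : ContMDiff (velModel n k) 𝓘(ℝ, ℝ) ∞ L)
    {Z : KVectorField (whitneyModel n k) (Whitney n k Q) k}
    {y : Euc n × ((Euc k →L[ℝ] Euc n) × (Euc n →L[ℝ] Euc k))} (hy : y.1 ∈ e.target)
    (h : SolvesUnifiedAt L Z (whitneyPoint e y)) (ξ : Euc n) (R : Euc n →L[ℝ] Euc k) :
    ∑ A, (R (dirDeriv (whitneyModel n k) (fun z => coordQ e (pr₂ z)) (whitneyPoint e y)
        (Z.comp A (whitneyPoint e y))) A -
      dirDeriv (whitneyModel n k) (fun z => coordP e (pr₂ z)) (whitneyPoint e y)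
        (Z.comp A (whitneyPoint e y)) ξ A) =
      pairing n k R y.2.1 - fderiv ℝ (localLagrangian L e) (y.1, y.2.1) (ξ, 0) := by
  have hz : (whitneyPoint e y : Whitney n k Q).1 ∈ e.source := e.map_target hy
  have hκ := (contMDiffAt_whitneyPoint (k := k) he hy).mdifferentiableAt (by simp)
  have hpr := contMDiff_pr₂ (n := n) (k := k) (Q := Q) (whitneyPoint e y)
  have hp := ((contMDiffAt_coordP (k := k) (α₀ := pr₂ (whitneyPoint e y)) he hz).comp _
    hpr).mdifferentiableAt (by simp)
  have hq := ((contMDiffAt_coordQ (k := k) (α₀ := pr₂ (whitneyPoint e y)) he hz).comp _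
    hpr).mdifferentiableAt (by simp)
  have hH : MDifferentiableAt (whitneyModel n k) 𝓘(ℝ, ℝ) (unifiedHamiltonian L)
      (whitneyPoint e y) :=
    (contMDiffAt_unifiedHamiltonian he hL hz).mdifferentiableAt (by simp)
  have hev : ∀ᶠ y' : Euc n × ((Euc k →L[ℝ] Euc n) × (Euc n →L[ℝ] Euc k)) in 𝓝 y,
      covCoord e (pr₂ (whitneyPoint e y' : Whitney n k Q)) = (y'.1, y'.2.2) := by
    filter_upwards [continuousAt_fst.eventually_mem (e.open_target.mem_nhds hy)] with y' hy'
    exact covCoord_covPoint he hy' _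
  have hqev : (fun y' => coordQ e (pr₂ (whitneyPoint e y' : Whitney n k Q))) =ᶠ[𝓝 y]
      fun y' => y'.1 := hev.mono fun _ h => congrArg Prod.fst h
  have hpev : (fun y' => coordP e (pr₂ (whitneyPoint e y' : Whitney n k Q))) =ᶠ[𝓝 y]
      fun y' => y'.2.2 := hev.mono fun _ h => congrArg Prod.snd h
  -- The test vector has coordinates `(ξ, 0, R)`: arbitrary base and momentum parts, no velocity
  -- part.
  have hY := h (mfderiv 𝓘(ℝ, Euc n × ((Euc k →L[ℝ] Euc n) × (Euc n →L[ℝ] Euc k)))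
    (whitneyModel n k) (whitneyPoint e) y (ξ, 0, R))
  have hdq : dirDeriv (whitneyModel n k) (fun z => coordQ e (pr₂ z)) (whitneyPoint e y)
      (mfderiv 𝓘(ℝ, Euc n × ((Euc k →L[ℝ] Euc n) × (Euc n →L[ℝ] Euc k)))
        (whitneyModel n k) (whitneyPoint e : _ → Whitney n k Q) y (ξ, 0, R)) = ξ := by
    refine (dirDeriv_mfderiv_eq_fderiv hq hκ _).trans ?_
    exact congrArg (fun D => D (ξ, 0, R)) (hqev.fderiv_eq.trans (fderiv_fst (𝕜 := ℝ)))
  have hdp : dirDeriv (whitneyModel n k) (fun z => coordP e (pr₂ z)) (whitneyPoint e y)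
      (mfderiv 𝓘(ℝ, Euc n × ((Euc k →L[ℝ] Euc n) × (Euc n →L[ℝ] Euc k)))
        (whitneyModel n k) (whitneyPoint e : _ → Whitney n k Q) y (ξ, 0, R)) = R := by
    refine (dirDeriv_mfderiv_eq_fderiv hp hκ _).trans ?_
    have := ((ContinuousLinearMap.snd ℝ (Euc k →L[ℝ] Euc n) (Euc n →L[ℝ] Euc k)).comp
      (ContinuousLinearMap.snd ℝ (Euc n) ((Euc k →L[ℝ] Euc n) × (Euc n →L[ℝ] Euc k)))).hasFDerivAt
        (x := y)
    exact congrArg (fun D => D (ξ, 0, R)) (hpev.fderiv_eq.trans this.fderiv)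
  have hdH : mfderiv (whitneyModel n k) 𝓘(ℝ, ℝ) (unifiedHamiltonian L) (whitneyPoint e y)
      (mfderiv 𝓘(ℝ, Euc n × ((Euc k →L[ℝ] Euc n) × (Euc n →L[ℝ] Euc k)))
        (whitneyModel n k) (whitneyPoint e : _ → Whitney n k Q) y (ξ, 0, R)) =
      pairing n k R y.2.1 - fderiv ℝ (localLagrangian L e) (y.1, y.2.1) (ξ, 0) := by
    rw [← fderiv_unifiedHamiltonian_whitneyPoint he hL hy]
    exact dirDeriv_mfderiv_eq_fderiv hH hκ _
  refine Eq.trans ?_ (hY.trans hdH)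
  refine Finset.sum_congr rfl fun A _ => ?_
  rw [unifiedForm_eq he A hz, hdq, hdp]

end Unified

/-! ### The Legendre map in coordinates -/

section Legendre

variable {n k : ℕ} {Q : Type*} [TopologicalSpace Q] [ChartedSpace (Euc n) Q]
  {e : OpenPartialHomeomorph Q (Euc n)}

/-- The chart is linear on fibres, so the flow `eˢ v` is scaling of the velocity coordinates, with
derivative `(0, v)` at `s = 0`. -/
theorem energy_velPoint {L : Vel n k Q → ℝ} {y : Euc n × (Euc k →L[ℝ] Euc n)}
    (hl : DifferentiableAt ℝ (localLagrangian L e) y) :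
    energy L (velPoint e y.1 y.2) = localEnergy (localLagrangian L e) y := by
  have h1 : (fun s : ℝ => L ⟨e.symm y.1, Real.exp s • (velPoint e y.1 y.2 : Vel n k Q).2⟩) =
      fun s => localLagrangian L e (y.1, Real.exp s • y.2) := by
    ext s
    exact congrArg (fun v => L ⟨e.symm y.1, v⟩)
      (ContinuousLinearMap.comp_smul (symmDeriv e y.1) (Real.exp s) y.2).symm
  have h2 : HasDerivAt (fun s : ℝ => (y.1, Real.exp s • y.2)) (0, y.2) 0 := by
    have := (Real.hasDerivAt_exp 0).smul_const y.2
    rw [Real.exp_zero, one_smul] at this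
    exact (hasDerivAt_const (0 : ℝ) y.1).prodMk this
  have h3 : HasFDerivAt (localLagrangian L e) (fderiv ℝ (localLagrangian L e) y)
      (y.1, Real.exp 0 • y.2) := by
    rw [Real.exp_zero, one_smul]; exact hl.hasFDerivAt
  have h4 := (h3.comp_hasDerivAt (0 : ℝ) h2).deriv
  change deriv (fun s : ℝ => L ⟨e.symm y.1, Real.exp s • (velPoint e y.1 y.2 : Vel n k Q).2⟩) 0 -
    L (velPoint e y.1 y.2) = _
  rw [h1]
  exact congrArg (fun r => r - L (velPoint e y.1 y.2)) h4

/-- A variation `w` in the `A`-th tangent vector has coordinates `De(w)` in the `A`-th slot; the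
chain rule then gives `∂L/∂v_A ∘ De`. -/
theorem legendreComponent_velPoint (he : e ∈ IsManifold.maximalAtlas (𝓡 n) ∞ Q)
    {L : Vel n k Q → ℝ} {y : Euc n × (Euc k →L[ℝ] Euc n)} (hy : y.1 ∈ e.target)
    (hl : DifferentiableAt ℝ (localLagrangian L e) y) (A : Fin k) :
    legendreComponent L (velPoint e y.1 y.2) A =
      (((fderiv ℝ (localLagrangian L e) y).comp (ContinuousLinearMap.inr ℝ _ _)).comp
        (inclVel n A)).comp (chartDeriv e (e.symm y.1)) := by
  have hid : (symmDeriv e y.1).comp (chartDeriv e (e.symm y.1)) =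
      ContinuousLinearMap.id ℝ (Euc n) := by
    have := symmDeriv_comp_chartDeriv he (e.map_target hy)
    rwa [e.right_inv hy] at this
  have h1 : (fun w : Euc n => L ⟨e.symm y.1, (velPoint e y.1 y.2 : Vel n k Q).2 +
      singleVel (velPoint e y.1 y.2 : Vel n k Q).1 A w⟩) = fun w => localLagrangian L e
        (y.1, y.2 + inclVel n A (chartDeriv e (e.symm y.1) w)) := by
    ext w
    refine congrArg (fun v : Euc k →L[ℝ] Euc n => L ⟨e.symm y.1, v⟩)
      (?_ : (symmDeriv e y.1).comp y.2 + inclVel n A w = (symmDeriv e y.1).comp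
        (y.2 + inclVel n A (chartDeriv e (e.symm y.1) w)))
    rw [ContinuousLinearMap.comp_add]
    congr 1
    have h := congrArg (fun D : Euc n →L[ℝ] Euc n => D w) hid
    simp only [ContinuousLinearMap.comp_apply, ContinuousLinearMap.id_apply] at h
    rw [inclVel_apply, inclVel_apply]
    ext1 v
    simp [h]
  have h2 : HasFDerivAt (fun w : Euc n => (y.1, y.2 + inclVel n A (chartDeriv e (e.symm y.1) w)))
      ((0 : Euc n →L[ℝ] Euc n).prod ((inclVel n A).comp (chartDeriv e (e.symm y.1)))) 0 :=
    (hasFDerivAt_const y.1 0).prodMk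
      (((inclVel n A).comp (chartDeriv e (e.symm y.1))).hasFDerivAt.const_add y.2)
  have h3 : HasFDerivAt (localLagrangian L e) (fderiv ℝ (localLagrangian L e) y)
      (y.1, y.2 + inclVel n A (chartDeriv e (e.symm y.1) 0)) := by
    rw [map_zero, map_zero, add_zero]; exact hl.hasFDerivAt
  have h4 := (h3.comp (0 : Euc n) h2).fderiv
  change fderiv ℝ (fun w : Euc n => L ⟨e.symm y.1, (velPoint e y.1 y.2 : Vel n k Q).2 +
    singleVel (velPoint e y.1 y.2 : Vel n k Q).1 A w⟩) 0 = _
  rw [h1]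
  refine Eq.trans h4 ?_
  ext1 w
  rfl

theorem legendre_velPoint (he : e ∈ IsManifold.maximalAtlas (𝓡 n) ∞ Q)
    {L : Vel n k Q → ℝ} {y : Euc n × (Euc k →L[ℝ] Euc n)} (hy : y.1 ∈ e.target)
    (hl : DifferentiableAt ℝ (localLagrangian L e) y) :
    legendre L (velPoint e y.1 y.2) =
      covPoint e y.1 (fiberDeriv (momentum n k) (localLagrangian L e) y) := by
  have h : (∑ A, (legendreComponent L (velPoint e y.1 y.2) A).smulRight (basisVec A) :
      Euc n →L[ℝ] Euc k) = (fiberDeriv (momentum n k) (localLagrangian L e) y).comp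
        (chartDeriv e (e.symm y.1)) := by
    rw [fiberDeriv, momentum_eq, ContinuousLinearMap.finsetSum_comp]
    refine Finset.sum_congr rfl fun A _ => ?_
    rw [legendreComponent_velPoint he hy hl]
    rfl
  exact congrArg (TotalSpace.mk (e.symm y.1)) h

theorem IsRegularLagrangian.isNondegenerateAt {L : Vel n k Q → ℝ} (hreg : IsRegularLagrangian L)
    (he : e ∈ IsManifold.maximalAtlas (𝓡 n) ∞ Q) {y : Euc n × (Euc k →L[ℝ] Euc n)}
    (hy : y.1 ∈ e.target) (hl : ContDiffAt ℝ ∞ (localLagrangian L e) y) :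
    IsNondegenerateAt (localLagrangian L e) y :=
  isNondegenerateAt_of_det (fun a : Fin n × Fin k => velDir a.1 a.2)
    (fun W a => W (basisVec a.2) a.1) sum_velDir hl (hreg e he y.1 hy y.2)

variable [IsManifold (𝓡 n) ∞ Q]

/-- The Legendre map of a regular Lagrangian is a local homeomorphism. -/
theorem exists_openPartialHomeomorph_legendre {L : Vel n k Q → ℝ}
    (hL : ContMDiff (velModel n k) 𝓘(ℝ, ℝ) ∞ L) (hreg : IsRegularLagrangian L) (v : Vel n k Q) :
    ∃ Φ : OpenPartialHomeomorph (Vel n k Q) (Cov n k Q),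
      v ∈ Φ.source ∧ Set.EqOn (legendre L) Φ Φ.source := by
  have he := IsManifold.chart_mem_maximalAtlas (I := 𝓡 n) (n := ∞) v.1
  set e := chartAt (Euc n) v.1
  have hv : v.1 ∈ e.source := mem_chart_source _ _
  have hl := contDiffAt_localLagrangian he hL (y := velCoord e v) (e.map_source hv)
  obtain ⟨g, hg, hgl, -⟩ := exists_localLegendre_inverse finrank_vel_eq_finrank_cov
    pairing_momentum hl (hreg.isNondegenerateAt he (e.map_source hv) hl)
  refine ⟨((velChart he).trans g).trans (covChart he).symm, ?_, fun u hu => ?_⟩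
  · rw [OpenPartialHomeomorph.trans_source, OpenPartialHomeomorph.trans_source]
    refine ⟨⟨hv, hg⟩, ?_⟩
    -- `g` preserves the base coordinate, so its value stays in the target of the induced chart.
    change (g (velCoord e v)).1 ∈ e.target ∧ _
    rw [hgl]
    exact ⟨e.map_source hv, Set.mem_univ _⟩
  · rw [OpenPartialHomeomorph.trans_source, OpenPartialHomeomorph.trans_source] at hu
    have hu' : u.1 ∈ e.source := hu.1.1
    have hlu := contDiffAt_localLagrangian he hL (y := velCoord e u) (e.map_source hu')
    have h := legendre_velPoint he (e.map_source hu') (hlu.differentiableAt (by simp))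
    rw [velPoint_velCoord he hu'] at h
    rw [h]
    change _ = covPoint e (g (velCoord e u)).1 (g (velCoord e u)).2
    rw [hgl]
    rfl

/-- A function that corresponds to the energy under the Legendre map is smooth. -/
theorem contMDiffAt_of_comp_legendre {L : Vel n k Q → ℝ}
    (hL : ContMDiff (velModel n k) 𝓘(ℝ, ℝ) ∞ L) (hreg : IsRegularLagrangian L)
    {U : Set (Vel n k Q)} (hU : IsOpen U) {H : Cov n k Q → ℝ}
    (hH : ∀ u ∈ U, H (legendre L u) = energy L u) {v : Vel n k Q} (hvU : v ∈ U) :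
    ContMDiffAt (covModel n k) 𝓘(ℝ, ℝ) ∞ H (legendre L v) := by
  have he := IsManifold.chart_mem_maximalAtlas (I := 𝓡 n) (n := ∞) v.1
  set e := chartAt (Euc n) v.1
  have hv : v.1 ∈ e.source := mem_chart_source _ _
  set y := velCoord e v with hy_def
  have hy : y.1 ∈ e.target := e.map_source hv
  have hl := contDiffAt_localLagrangian he hL hy
  obtain ⟨g, hg, hgl, hgs⟩ := exists_localLegendre_inverse finrank_vel_eq_finrank_cov
    pairing_momentum hl (hreg.isNondegenerateAt he hy hl)
  have hleg := legendre_velPoint he hy (hl.differentiableAt (by simp))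
  have hvy : velPoint e y.1 y.2 = v := velPoint_velCoord he hv
  rw [hvy] at hleg
  have hcov : covCoord e (legendre L v) = localLegendre (momentum n k) (localLagrangian L e) y := by
    rw [hleg, covCoord_covPoint he hy]; rfl
  have hgy : g.symm (covCoord e (legendre L v)) = y := by rw [hcov, ← hgl, g.left_inv hg]
  have hc : ContMDiffAt (covModel n k) 𝓘(ℝ, Euc n × (Euc n →L[ℝ] Euc k)) ∞ (covCoord e)
      (legendre L v) := contMDiffAt_covCoord he hv
  rw [← hcov] at hgs
  have hs : ContMDiffAt (covModel n k) 𝓘(ℝ, Euc n × (Euc k →L[ℝ] Euc n)) ∞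
      (fun α => g.symm (covCoord e α)) (legendre L v) := hgs.contMDiffAt.comp _ hc
  have hE : ContMDiffAt 𝓘(ℝ, Euc n × (Euc k →L[ℝ] Euc n)) 𝓘(ℝ, ℝ) ∞
      (localEnergy (localLagrangian L e)) (g.symm (covCoord e (legendre L v))) := by
    rw [hgy]; exact hl.localEnergy.contMDiffAt
  refine (hE.comp (legendre L v) hs).congr_of_eventuallyEq ?_
  have hU' : ∀ᶠ w in 𝓝 y, w.1 ∈ e.target ∧ velPoint e w.1 w.2 ∈ U :=
    (continuousAt_fst.eventually_mem (e.open_target.mem_nhds hy)).and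
      ((contMDiffAt_velPoint he hy).continuousAt.eventually_mem (hU.mem_nhds (hvy ▸ hvU)))
  have hs' : Filter.Tendsto (fun α => g.symm (covCoord e α)) (𝓝 (legendre L v)) (𝓝 y) := by
    have := hs.continuousAt
    rwa [ContinuousAt, hgy] at this
  have hgt : covCoord e (legendre L v) ∈ g.target := by
    rw [hcov, ← hgl]; exact g.map_source hg
  have hsrc : ∀ᶠ α : Cov n k Q in 𝓝 (legendre L v), α.1 ∈ e.source :=
    (FiberBundle.continuous_proj (Euc n →L[ℝ] Euc k) (CovFiber n k Q)).continuousAt.eventually_mem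
      (e.open_source.mem_nhds hv)
  filter_upwards [hs'.eventually hU', hsrc,
    hc.continuousAt.eventually_mem (g.open_target.mem_nhds hgt)] with α hα hα1 hα2
  -- For `α` near `FL(v)`, the point with coordinates `g.symm (covCoord e α)` lies in `U` and is
  -- mapped to `α` by `FL`. Hence `hH` determines `H α`, although `H` is constrained only on
  -- `FL(U)`.
  obtain ⟨h1, h2⟩ := hα
  have hlw := contDiffAt_localLagrangian he hL h1
  have h3 := legendre_velPoint he h1 (hlw.differentiableAt (by simp))
  have h4 : localLegendre (momentum n k) (localLagrangian L e) (g.symm (covCoord e α)) =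
      covCoord e α := by rw [← hgl, g.right_inv hα2]
  have h5 : covPoint e (g.symm (covCoord e α)).1 (fiberDeriv (momentum n k) (localLagrangian L e)
      (g.symm (covCoord e α))) = α := by
    refine Eq.trans ?_ (covPoint_covCoord he hα1)
    rw [← h4, ← hgl, g.left_inv (g.map_target hα2), hgl]
    rfl
  rw [h5] at h3
  have h6 := hH _ h2
  rw [h3, energy_velPoint (hlw.differentiableAt (by simp))] at h6
  exact h6

end Legendre

/-! ### Integral sections and partial derivatives of the Hamiltonian. -/

section FieldEquations

variable {n k : ℕ} {Q : Type*} [TopologicalSpace Q] [ChartedSpace (Euc n) Q]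
  {e : OpenPartialHomeomorph Q (Euc n)}

/-- The coordinate expression of a Hamiltonian. -/
noncomputable def localHamiltonian (H : Cov n k Q → ℝ) (e : OpenPartialHomeomorph Q (Euc n))
    (w : Euc n × (Euc n →L[ℝ] Euc k)) : ℝ :=
  H (covPoint e w.1 w.2)

theorem partialP_eq_fderiv {H : Cov n k Q → ℝ} {α : Cov n k Q}
    (hH : DifferentiableAt ℝ (localHamiltonian H e) (covCoord e α)) (A : Fin k) (i : Fin n) :
    partialP e H A i α = fderiv ℝ (localHamiltonian H e) (covCoord e α) (0, covDir A i) :=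
  deriv_line_snd (x := coordQ e α) (v := coordP e α) hH (covDir A i)

theorem partialQ_eq_fderiv {H : Cov n k Q → ℝ} {α : Cov n k Q}
    (hH : DifferentiableAt ℝ (localHamiltonian H e) (covCoord e α)) (i : Fin n) :
    partialQ e H i α = fderiv ℝ (localHamiltonian H e) (covCoord e α) (basisVec i, 0) :=
  deriv_line_fst (x := coordQ e α) (v := coordP e α) hH (basisVec i)

theorem lineDeriv_clm_comp {E X : Type*} [NormedAddCommGroup E] [NormedSpace ℝ E]
    [NormedAddCommGroup X] [NormedSpace ℝ X] (T : X →L[ℝ] ℝ) {f : E → X} {g : E → ℝ} {t : E}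
    (hf : DifferentiableAt ℝ f t) (hg : g =ᶠ[𝓝 t] fun t => T (f t)) (u : E) :
    lineDeriv ℝ g t u = T (fderiv ℝ f t u) :=
  (((T.hasFDerivAt.comp t hf.hasFDerivAt).congr_of_eventuallyEq hg).hasLineDerivAt u).lineDeriv

variable [IsManifold (𝓡 n) ∞ Q]

/-- The defining equation of an integral section turns derivatives along `Z_A` into partial
derivatives with respect to `t^A`. -/
theorem dirDeriv_integralSection {X : Type*} [NormedAddCommGroup X] [NormedSpace ℝ X]
    {Z : KVectorField (whitneyModel n k) (Whitney n k Q) k} {U₀ : Set (Euc k)}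
    {ψ : Euc k → Whitney n k Q} (hψ : Z.IsIntegralSection U₀ ψ) {t : Euc k} (ht : t ∈ U₀)
    {f : Whitney n k Q → X} (hf : ContMDiffAt (whitneyModel n k) 𝓘(ℝ, X) ∞ f (ψ t)) (A : Fin k) :
    DifferentiableAt ℝ (fun t => f (ψ t)) t ∧
      dirDeriv (whitneyModel n k) f (ψ t) (Z.comp A (ψ t)) =
        fderiv ℝ (fun t => f (ψ t)) t (basisVec A) := by
  have hψt := hψ.smooth.contMDiffAt (hψ.isOpen.mem_nhds ht)
  refine ⟨(hf.comp t hψt).contDiffAt.differentiableAt (by simp), ?_⟩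
  rw [← hψ.eq t ht A]
  exact dirDeriv_mfderiv_eq_fderiv (hf.mdifferentiableAt (by simp))
    (hψt.mdifferentiableAt (by simp)) _

variable {L : Vel n k Q → ℝ} {Z : KVectorField (whitneyModel n k) (Whitney n k Q) k}
  {U₀ : Set (Euc k)} {ψ : Euc k → Whitney n k Q}

/-- The equation `∑_A ι_{Z_A} Ω_A = dℋ` along an integral section, in coordinates. -/
theorem sum_lineDeriv_integralSection (he : e ∈ IsManifold.maximalAtlas (𝓡 n) ∞ Q)
    (hL : ContMDiff (velModel n k) 𝓘(ℝ, ℝ) ∞ L) (hψ : Z.IsIntegralSection U₀ ψ)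
    {t : Euc k} (ht : t ∈ U₀) (hsol : SolvesUnifiedAt L Z (ψ t))
    {φ : Euc k → Cov n k Q} (hφ : ∀ s ∈ U₀, φ s = pr₂ (ψ s))
    {y : Euc n × ((Euc k →L[ℝ] Euc n) × (Euc n →L[ℝ] Euc k))} (hy : y.1 ∈ e.target)
    (hyt : whitneyPoint e y = ψ t) :
    (∀ (A : Fin k) (i : Fin n), lineDeriv ℝ (fun s => coordQ e (φ s) i) t (basisVec A) =
      pairing n k (covDir A i) y.2.1) ∧
    ∀ i : Fin n, ∑ A, lineDeriv ℝ (fun s => coordP e (φ s) (basisVec i) A) t (basisVec A) =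
      fderiv ℝ (localLagrangian L e) (y.1, y.2.1) (basisVec i, 0) := by
  have hz : (ψ t).1 ∈ e.source := by rw [← hyt]; exact e.map_target hy
  have hq := (contMDiffAt_coordQ (k := k) (α₀ := pr₂ (ψ t)) he hz).comp _ (contMDiff_pr₂ (ψ t))
  have hp := (contMDiffAt_coordP (k := k) (α₀ := pr₂ (ψ t)) he hz).comp _ (contMDiff_pr₂ (ψ t))
  have hev : ∀ᶠ s in 𝓝 t, φ s = pr₂ (ψ s) :=
    Filter.eventually_of_mem (hψ.isOpen.mem_nhds ht) hφ
  have key : ∀ (ξ : Euc n) (R : Euc n →L[ℝ] Euc k),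
      ∑ A, (R (fderiv ℝ (fun s => coordQ e (pr₂ (ψ s))) t (basisVec A)) A -
        fderiv ℝ (fun s => coordP e (pr₂ (ψ s))) t (basisVec A) ξ A) =
      pairing n k R y.2.1 - fderiv ℝ (localLagrangian L e) (y.1, y.2.1) (ξ, 0) := by
    intro ξ R
    have h := hsol
    rw [← hyt] at h
    have h' := h.eq_coord he hL hy ξ R
    rw [hyt] at h'
    rw [← h']
    refine Finset.sum_congr rfl fun A _ => ?_
    have h1 := (dirDeriv_integralSection hψ ht hq A).2
    have h2 := (dirDeriv_integralSection hψ ht hp A).2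
    exact congrArg₂ (fun a (b : Euc n →L[ℝ] Euc k) => R a A - b ξ A) h1.symm h2.symm
  constructor
  · intro A i
    -- The values of `covDir A i` are multiples of `e_A`, so only the `A`-th summand survives, and
    -- it is `∂q^i/∂t^A`.
    have h := key 0 (covDir A i)
    have h0 : ∀ y, fderiv ℝ (localLagrangian L e) y ((0 : Euc n), (0 : Euc k →L[ℝ] Euc n)) = 0 :=
      fun y => (fderiv ℝ (localLagrangian L e) y).map_zero
    rw [h0, sub_zero] at h
    rw [← h, lineDeriv_clm_comp (EuclideanSpace.proj i : Euc n →L[ℝ] ℝ)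
      (dirDeriv_integralSection hψ ht hq A).1 (hev.mono fun s hs => by rw [hs]; rfl)]
    simp [covDir]
  · intro i
    -- With `R = 0` both pairing terms vanish and the divergence of the momenta remains.
    have h := key (basisVec i) 0
    rw [pairing_zero_left, zero_sub] at h
    rw [← neg_neg (fderiv ℝ (localLagrangian L e) _ _), ← h, ← Finset.sum_neg_distrib]
    refine Finset.sum_congr rfl fun A _ => ?_
    rw [lineDeriv_clm_comp ((EuclideanSpace.proj A : Euc k →L[ℝ] ℝ).comp
        (ContinuousLinearMap.apply ℝ (Euc k) (basisVec i : Euc n)))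
      (dirDeriv_integralSection hψ ht hp A).1 (hev.mono fun s hs => by rw [hs]; rfl)]
    simp

/-- The partial derivatives of a Hamiltonian that corresponds to the energy of `L`. -/
theorem partialP_and_partialQ_eq (he : e ∈ IsManifold.maximalAtlas (𝓡 n) ∞ Q)
    (hL : ContMDiff (velModel n k) 𝓘(ℝ, ℝ) ∞ L) (hreg : IsRegularLagrangian L)
    {U : Set (Vel n k Q)} (hU : IsOpen U) {H : Cov n k Q → ℝ}
    (hH : ∀ u ∈ U, H (legendre L u) = energy L u) {y : Euc n × (Euc k →L[ℝ] Euc n)}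
    (hy : y.1 ∈ e.target) (hyU : velPoint e y.1 y.2 ∈ U) :
    (∀ (A : Fin k) (i : Fin n), partialP e H A i (legendre L (velPoint e y.1 y.2)) =
      pairing n k (covDir A i) y.2) ∧
    ∀ i : Fin n, partialQ e H i (legendre L (velPoint e y.1 y.2)) =
      -fderiv ℝ (localLagrangian L e) y (basisVec i, 0) := by
  have hl := contDiffAt_localLagrangian he hL hy
  have hleg : ∀ {w : Euc n × (Euc k →L[ℝ] Euc n)}, w.1 ∈ e.target →
      legendre L (velPoint e w.1 w.2) =
        covPoint e w.1 (fiberDeriv (momentum n k) (localLagrangian L e) w) := fun hw =>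
    legendre_velPoint he hw ((contDiffAt_localLagrangian he hL hw).differentiableAt (by simp))
  have hcov : covCoord e (legendre L (velPoint e y.1 y.2)) =
      localLegendre (momentum n k) (localLagrangian L e) y := by
    rw [hleg hy, covCoord_covPoint he hy]; rfl
  have hHs := contMDiffAt_of_comp_legendre hL hreg hU hH hyU
  rw [hleg hy] at hHs
  have hd : DifferentiableAt ℝ (localHamiltonian H e)
      (localLegendre (momentum n k) (localLagrangian L e) y) :=
    (ContMDiffAt.comp (localLegendre (momentum n k) (localLagrangian L e) y)
      (f := fun w => covPoint e w.1 w.2) hHs (contMDiffAt_covPoint (y₀ := localLegendre (momentum n k)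
      (localLagrangian L e) y) he hy)).contDiffAt.differentiableAt (by simp)
  have heq : ∀ᶠ w in 𝓝 y, localHamiltonian H e
      (localLegendre (momentum n k) (localLagrangian L e) w) =
        localEnergy (localLagrangian L e) w := by
    filter_upwards [continuousAt_fst.eventually_mem (e.open_target.mem_nhds hy),
      (contMDiffAt_velPoint he hy).continuousAt.eventually_mem (hU.mem_nhds hyU)] with w hw hwU
    rw [← energy_velPoint ((contDiffAt_localLagrangian he hL hw).differentiableAt (by simp)),
      ← hH _ hwU, hleg hw]
    rfl
  have key := fderiv_hamiltonian finrank_vel_eq_finrank_cov pairing_momentum hl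
    (hreg.isNondegenerateAt he hy hl) hd heq
  rw [← hcov] at hd key
  refine ⟨fun A i => ?_, fun i => ?_⟩
  · rw [partialP_eq_fderiv hd, key]
    exact (congrArg _ (fderiv ℝ (localLagrangian L e) y).map_zero).trans (sub_zero _)
  · rw [partialQ_eq_fderiv hd, key, pairing_zero_left, zero_sub]

end FieldEquations

end KSymplectic

/-! ### Local Hamiltonians and the Hamilton–De Donder–Weyl equations. -/

open KSymplectic in
theorem mainTheorem8 {n k : ℕ} {Q : Type*} [TopologicalSpace Q] [ChartedSpace (Euc n) Q]
    [IsManifold (𝓡 n) ∞ Q]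
    (L : Vel n k Q → ℝ) (hL : ContMDiff (velModel n k) 𝓘(ℝ, ℝ) ∞ L) (hreg : IsRegularLagrangian L)
    (Z : KVectorField (whitneyModel n k) (Whitney n k Q) k)
    (hint : Z.IsIntegrableOn (legendreGraph L))
    (hsol : ∀ z ∈ legendreGraph L, SolvesUnifiedAt L Z z)
    (U₀ : Set (Euc k)) (ψ : Euc k → Whitney n k Q) (hψ : Z.IsIntegralSection U₀ ψ)
    (hmem : ∀ t ∈ U₀, ψ t ∈ legendreGraph L) :
    (∀ v : Vel n k Q, ∃ (U : Set (Vel n k Q)) (H : Cov n k Q → ℝ),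
      IsOpen U ∧ v ∈ U ∧ Set.InjOn (legendre L) U ∧ IsOpen (legendre L '' U) ∧
      ContMDiffOn (covModel n k) 𝓘(ℝ, ℝ) ∞ H (legendre L '' U) ∧
      ∀ u ∈ U, H (legendre L u) = energy L u) ∧
    ∀ (U : Set (Vel n k Q)) (H : Cov n k Q → ℝ), IsOpen U →
      (∀ u ∈ U, H (legendre L u) = energy L u) →
      IsHDWSolution H {t | t ∈ U₀ ∧ pr₁ (ψ t) ∈ U} (fun t => legendre L (pr₁ (ψ t))) := by
  refine ⟨fun v => ?_, fun U H hU hH => ?_⟩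
  · obtain ⟨Φ, hv, hΦ⟩ := exists_openPartialHomeomorph_legendre hL hreg v
    have hH : ∀ u ∈ Φ.source, (fun α => energy L (Φ.symm α)) (legendre L u) = energy L u :=
      fun u hu => by dsimp only; rw [hΦ hu, Φ.left_inv hu]
    -- `Φ` is given only as a local homeomorphism; smoothness of `E_L ∘ Φ⁻¹` comes from
    -- `contMDiffAt_of_comp_legendre`.
    refine ⟨Φ.source, fun α => energy L (Φ.symm α), Φ.open_source, hv,
      Φ.injOn.congr hΦ.symm, ?_, ?_, hH⟩
    · rw [hΦ.image_eq, Φ.image_source_eq_target]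
      exact Φ.open_target
    · rintro _ ⟨u, hu, rfl⟩
      exact (contMDiffAt_of_comp_legendre hL hreg Φ.open_source hH hu).contMDiffWithinAt
  · have hφ : ∀ s ∈ U₀, legendre L (pr₁ (ψ s)) = pr₂ (ψ s) := fun s hs => (hmem s hs).symm
    have hcoord : ∀ e ∈ IsManifold.maximalAtlas (𝓡 n) ∞ Q, ∀ t ∈ {t | t ∈ U₀ ∧ pr₁ (ψ t) ∈ U},
        (ψ t).1 ∈ e.source → ∀ i : Fin n,
        partialQ e H i (legendre L (pr₁ (ψ t))) = -∑ A, lineDeriv ℝ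
          (fun t' => coordP e (legendre L (pr₁ (ψ t'))) (basisVec i) A) t (basisVec A) ∧
        ∀ A : Fin k, partialP e H A i (legendre L (pr₁ (ψ t))) = lineDeriv ℝ
          (fun t' => coordQ e (legendre L (pr₁ (ψ t'))) i) t (basisVec A) := by
      rintro e he t ⟨ht, htU⟩ hte i
      obtain ⟨y, hy, hyt⟩ := exists_whitneyPoint_eq he hte
      have h1 := sum_lineDeriv_integralSection he hL hψ ht (hsol _ (hmem t ht)) hφ hy hyt
      have hpr : velPoint e y.1 y.2.1 = pr₁ (ψ t) := by rw [← hyt]; rfl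
      have h2 := partialP_and_partialQ_eq he hL hreg hU hH (y := (y.1, y.2.1)) hy
        (by rw [hpr]; exact htU)
      rw [hpr] at h2
      exact ⟨by rw [h2.2, h1.2], fun A => by rw [h2.1, h1.1]⟩
    refine ⟨?_, ?_, fun t ht => contMDiffAt_of_comp_legendre hL hreg hU hH ht.2,
      fun e he t ht hte i => (hcoord e he t ht hte i).1,
      fun e he t ht hte A i => (hcoord e he t ht hte i).2 A⟩
    · exact (contMDiff_pr₁.continuous.comp_continuousOn hψ.smooth.continuousOn).isOpen_inter_preimage
        hψ.isOpen hU
    -- On `U₀` the map `ψ_H` is `pr₂ ∘ ψ`, so its smoothness does not require that of `FL`.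
    · refine ((contMDiff_pr₂.comp_contMDiffOn hψ.smooth).mono fun t ht => ht.1).congr
        fun t ht => hφ t ht.1
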